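/- Let $\Omega\subset\mathbb R^3$ be a bounded domain with smooth boundary $\Gamma=\partial\Omega$ and outward unit normal $\nu$, and let $K>0$, $p\in[0,3)$, $q\in[0,\infty)$. Let $h:\mathbb R\to\mathbb R$ be real analytic with $h',h''\in L^\infty(\mathbb R)$ and $|h'''(s)|\le c(1+|s|^q)$ for all $s$, with some $c>0$. Let $F,F_\Gamma:\mathbb R\to\mathbb R$ be real analytic, $f=F'$, $f_\Gamma=F_\Gamma'$, and suppose that there are positive constants $c_0,\dots,c_4$ with $$|f''(s)|\le c_0(1+|s|^p),\qquad |f_\Gamma''(s)|\le c_0(1+|s|^q),\qquad f'(s)\ge -c_4,\qquad f_\Gamma'(s)\ge -c_4\qquad\text{for all } s\in\mathbb R,$$ $$F(s)\ge c_1|s|-c_2,\qquad F_\Gamma(s)\ge c_1|s|-c_2\qquad\text{for all } |s|>c_3 .$$ Let $(u_0,\phi_0)\in H^2(\Omega)\times H^2(\Gamma)$ satisfy $K\partial_\nu u_0+u_0=h(\phi_0)$ a.e. on $\Gamma$. Let $(u,\phi)$ be a global strong solution of $$\partial_t u-\Delta u+f(u)=0\ \text{ in }\Omega\times(0,\infty),\qquad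 K\partial_\nu u+u=h(\phi)\ \text{ on }\Gamma\times(0,\infty),$$ $$\partial_t\phi-\Delta_\Gamma\phi+f_\Gamma(\phi)+h'(\phi)\,\partial_\nu u=0\ \text{ on }\Gamma\times(0,\infty),\qquad u(0)=u_0,\quad \phi(0)=\phi_0,$$ that is, $(u,\phi):[0,\infty)\to H^2(\Omega)\times H^2(\Gamma)$ is continuous, $(\partial_tu,\partial_t\phi)\in L^\infty(0,T;L^2(\Omega)\times L^2(\Gamma))$ for every $T>0$, and for every $t>0$ the equations hold almost everywhere in $\Omega$ and on $\Gamma$, respectively (for each $t>0$, $\partial_tu(t)$ and $\partial_t\phi(t)$ denote the representatives for which they do; $\partial_\nu u$ and $\Delta_\Gamma\phi$ are characterized by Green's formulas on $\Omega$ and $\Gamma$). Then $$\lim_{t\to\infty}\big(\|\partial_t u(t)\|_{L^2(\Omega)}^2+\|\partial_t\phi(t)\|_{L^2(\Gamma)}^2\big)^{1/2}=0 .$$ -/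

import Mathlib

open MeasureTheory Set Filter Topology
open scoped ContDiff

noncomputable section

namespace BulkSurfaceAC

/-- The ambient Euclidean space of dimension three. -/
abbrev E3 : Type := EuclideanSpace ℝ (Fin 3)

/-- `∂ᵢ ψ (x)` for a function on the ambient space. -/
def partialDeriv (i : Fin 3) (ψ : E3 → ℝ) (x : E3) : ℝ :=
  fderiv ℝ ψ x (EuclideanSpace.single i 1)

/-! ### The domain, its boundary, and the two measures -/

/-- `Ω` is a bounded domain (nonempty, open, connected) with smooth boundary: near each boundary
point, `Ω` is the sublevel set `{ρ < 0}` of a smooth function with nonvanishing differential. -/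
structure IsSmoothBoundedDomain (Ω : Set E3) : Prop where
  isOpen : IsOpen Ω
  isConnected : IsConnected Ω
  isBounded : Bornology.IsBounded Ω
  smooth_boundary : ∀ x ∈ frontier Ω, ∃ ρ : E3 → ℝ, ContDiff ℝ ∞ ρ ∧ fderiv ℝ ρ x ≠ 0 ∧
    ∀ᶠ y in 𝓝 x, (y ∈ Ω ↔ ρ y < 0)

/-- Lebesgue measure on `Ω`. -/
def bulkMeasure (Ω : Set E3) : Measure E3 := (volume : Measure E3).restrict Ω

/-- Surface measure on `Γ = ∂Ω`: the two-dimensional Hausdorff measure, normalized so that it is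
Lebesgue measure on planes, restricted to `Γ`. -/
def surfaceMeasure (Ω : Set E3) : Measure E3 := (μHE[2] : Measure E3).restrict (frontier Ω)

/-- `L²(Ω)`. -/
abbrev L2Bulk (Ω : Set E3) : Type := Lp ℝ 2 (bulkMeasure Ω)

/-- `L²(Γ)`, where `Γ = ∂Ω`. -/
abbrev L2Surf (Ω : Set E3) : Type := Lp ℝ 2 (surfaceMeasure Ω)

/-! ### Sobolev functions in the bulk -/

/-- `g ∈ L²(Ω)` is the weak derivative `∂ᵢ u` of `u ∈ L²(Ω)`. -/
def IsWeakDeriv (Ω : Set E3) (i : Fin 3) (u g : L2Bulk Ω) : Prop :=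
  ∀ η : E3 → ℝ, ContDiff ℝ ∞ η → HasCompactSupport η → tsupport η ⊆ Ω →
    ∫ x, u x * partialDeriv i η x ∂(bulkMeasure Ω) = -∫ x, g x * η x ∂(bulkMeasure Ω)

/-- The Sobolev space `H²(Ω)`: a function in `L²(Ω)` together with its weak derivatives of first
and second order, all in `L²(Ω)` (`hess i j` is `∂ⱼ ∂ᵢ u`). -/
structure H2Bulk (Ω : Set E3) where
  val : L2Bulk Ω
  grad : Fin 3 → L2Bulk Ω
  hess : Fin 3 → Fin 3 → L2Bulk Ω
  isWeakDeriv_grad : ∀ i, IsWeakDeriv Ω i val (grad i)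
  isWeakDeriv_hess : ∀ i j, IsWeakDeriv Ω j (grad i) (hess i j)

/-- The topology of the `H²(Ω)` norm: `L²` convergence of the function and of all its weak
derivatives of order at most two. -/
instance (Ω : Set E3) : TopologicalSpace (H2Bulk Ω) :=
  TopologicalSpace.induced (fun u => (u.val, u.grad, u.hess)) inferInstance

/-- The Laplacian `Δu ∈ L²(Ω)` of `u ∈ H²(Ω)`. -/
def H2Bulk.laplacian {Ω : Set E3} (u : H2Bulk Ω) : L2Bulk Ω := ∑ i, u.hess i i

/-- `g ∈ L²(Γ)` is the trace of `u` on `Γ`. The trace operator is the continuous extension to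
`H¹(Ω)` of the restriction of smooth functions to `Γ`: smooth functions converge to `u` in
`H¹(Ω)` while their restrictions to `Γ` converge to `g` in `L²(Γ)`. -/
def IsTrace {Ω : Set E3} (u : H2Bulk Ω) (g : L2Surf Ω) : Prop :=
  ∃ ψ : ℕ → E3 → ℝ, (∀ n, ContDiff ℝ ∞ (ψ n)) ∧
    Tendsto (fun n => eLpNorm (fun x => ψ n x - u.val x) 2 (bulkMeasure Ω)) atTop (𝓝 0) ∧
    (∀ i, Tendsto (fun n => eLpNorm (fun x => partialDeriv i (ψ n) x - u.grad i x) 2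
      (bulkMeasure Ω)) atTop (𝓝 0)) ∧
    Tendsto (fun n => eLpNorm (fun x => ψ n x - g x) 2 (surfaceMeasure Ω)) atTop (𝓝 0)

/-- `g ∈ L²(Γ)` is the outward normal derivative `∂_ν u` of `u ∈ H²(Ω)`: the unique element of
`L²(Γ)` for which Green's formula `∫_Γ g w dΓ = ∫_Ω (Δu w + ∇u · ∇w) dx` holds for every smooth
`w`. On a smooth bounded domain this is the trace of `∇u` multiplied by the outward unit normal. -/
def IsNormalDeriv {Ω : Set E3} (u : H2Bulk Ω) (g : L2Surf Ω) : Prop :=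
  ∀ w : E3 → ℝ, ContDiff ℝ ∞ w →
    ∫ x, g x * w x ∂(surfaceMeasure Ω) =
      ∫ x, (u.laplacian x * w x + ∑ i, u.grad i x * partialDeriv i w x) ∂(bulkMeasure Ω)

/-! ### Sobolev functions on the boundary surface -/

/-- The surface gradient at `x` of (the restriction to `Γ` of) a smooth function `ψ`: the
orthogonal projection of `∇ψ(x)` onto the tangent space of `Γ` at `x`. -/
def surfaceGradient (Γ : Set E3) (ψ : E3 → ℝ) (x : E3) : E3 :=
  (Submodule.span ℝ (tangentConeAt ℝ Γ x)).starProjection (gradient ψ x)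

/-- `φ ∈ H¹(Γ)` with surface gradient `G ∈ L²(Γ; ℝ³)`, given by its three components in the
ambient space: `φ` is the limit in `H¹(Γ)` of smooth functions. -/
def HasSurfaceGradient (Ω : Set E3) (φ : L2Surf Ω) (G : Fin 3 → L2Surf Ω) : Prop :=
  ∃ ψ : ℕ → E3 → ℝ, (∀ n, ContDiff ℝ ∞ (ψ n)) ∧
    Tendsto (fun n => eLpNorm (fun x => ψ n x - φ x) 2 (surfaceMeasure Ω)) atTop (𝓝 0) ∧
    ∀ i, Tendsto (fun n => eLpNorm
      (fun x => surfaceGradient (frontier Ω) (ψ n) x i - G i x) 2 (surfaceMeasure Ω)) atTop (𝓝 0)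

/-- The Sobolev space `H²(Γ)`: a function in `H¹(Γ)` whose surface gradient `∇_Γ φ` has components
`Dᵢ φ` in `H¹(Γ)`, together with its tangential derivatives of first and second order
(`hess i j` is `Dⱼ Dᵢ φ`). -/
structure H2Surf (Ω : Set E3) where
  val : L2Surf Ω
  grad : Fin 3 → L2Surf Ω
  hess : Fin 3 → Fin 3 → L2Surf Ω
  hasSurfaceGradient : HasSurfaceGradient Ω val grad
  hasSurfaceGradient_grad : ∀ i, HasSurfaceGradient Ω (grad i) (hess i)

/-- The topology of the `H²(Γ)` norm. -/
instance (Ω : Set E3) : TopologicalSpace (H2Surf Ω) :=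
  TopologicalSpace.induced (fun φ => (φ.val, φ.grad, φ.hess)) inferInstance

/-- `L ∈ L²(Γ)` is the Laplace--Beltrami operator `Δ_Γ φ` applied to `φ ∈ H²(Γ)`:
`∫_Γ L ξ dΓ = -∫_Γ ∇_Γ φ · ∇_Γ ξ dΓ` for every smooth `ξ`. -/
def IsLaplaceBeltrami {Ω : Set E3} (φ : H2Surf Ω) (L : L2Surf Ω) : Prop :=
  ∀ ξ : E3 → ℝ, ContDiff ℝ ∞ ξ →
    ∫ x, L x * ξ x ∂(surfaceMeasure Ω) =
      -∫ x, ∑ i, φ.grad i x * surfaceGradient (frontier Ω) ξ x i ∂(surfaceMeasure Ω)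

/-! ### Assumptions on the nonlinearities and on the initial data -/

/-- Assumptions on the coupling function `h`. -/
structure CouplingAssumption (q : ℝ) (h : ℝ → ℝ) : Prop where
  analytic : AnalyticOnNhd ℝ h univ
  bounded_deriv : ∃ M : ℝ, ∀ s, |deriv h s| ≤ M
  bounded_deriv_two : ∃ M : ℝ, ∀ s, |iteratedDeriv 2 h s| ≤ M
  growth : ∃ c : ℝ, 0 < c ∧ ∀ s, |iteratedDeriv 3 h s| ≤ c * (1 + |s| ^ q)

/-- Assumptions on the potentials `F`, `FΓ`, whose derivatives are the nonlinearities `f`, `fΓ` of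
the system (so that the first derivative of `f` is the second derivative of `F`, and so on). -/
structure PotentialAssumption (p q : ℝ) (F FΓ : ℝ → ℝ) : Prop where
  analytic_bulk : AnalyticOnNhd ℝ F univ
  analytic_surf : AnalyticOnNhd ℝ FΓ univ
  bounds : ∃ c₀ c₁ c₂ c₃ c₄ : ℝ, 0 < c₀ ∧ 0 < c₁ ∧ 0 < c₂ ∧ 0 < c₃ ∧ 0 < c₄ ∧
    (∀ s, |iteratedDeriv 3 F s| ≤ c₀ * (1 + |s| ^ p)) ∧
    (∀ s, |iteratedDeriv 3 FΓ s| ≤ c₀ * (1 + |s| ^ q)) ∧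
    (∀ s, c₃ < |s| → c₁ * |s| - c₂ ≤ F s) ∧
    (∀ s, c₃ < |s| → c₁ * |s| - c₂ ≤ FΓ s) ∧
    (∀ s, -c₄ ≤ iteratedDeriv 2 F s) ∧
    (∀ s, -c₄ ≤ iteratedDeriv 2 FΓ s)

/-- The Robin condition `K ∂_ν u + u = h(φ)` a.e. on `Γ`; `d` is the normal derivative of `u`. -/
def RobinCondition {Ω : Set E3} (K : ℝ) (h : ℝ → ℝ) (u : H2Bulk Ω) (φ : L2Surf Ω)
    (d : L2Surf Ω) : Prop :=
  IsNormalDeriv u d ∧ ∃ γ : L2Surf Ω, IsTrace u γ ∧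
    ∀ᵐ x ∂(surfaceMeasure Ω), K * d x + γ x = h (φ x)

/-! ### Strong solutions -/

/-- `w` is the time derivative of `y : [0,∞) → X`, with `w ∈ L^∞(0,T;X)` for every `T > 0`;
that is, `y ∈ W^{1,∞}(0,T;X)` for every `T > 0`. -/
def IsTimeDeriv {X : Type*} [NormedAddCommGroup X] [NormedSpace ℝ X] (y w : ℝ → X) : Prop :=
  (∀ T > 0, MemLp w ⊤ ((volume : Measure ℝ).restrict (Ioc 0 T))) ∧
    ∀ t ≥ 0, y t = y 0 + ∫ s in (0 : ℝ)..t, w s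

/-- `(u, φ)` is a global strong solution, with initial data `(u₀, φ₀)` and with time derivatives
`(ut, φt)`, of the system
* `∂ₜ u - Δu + F'(u) = 0` in `Ω × (0,∞)`,
* `K ∂_ν u + u = h(φ)` on `Γ × (0,∞)`,
* `∂ₜ φ - Δ_Γ φ + FΓ'(φ) + h'(φ) ∂_ν u = 0` on `Γ × (0,∞)`.

No bound that is uniform in time is part of the definition. The time derivatives, which are
determined as functions of time up to a null set, are evaluated at each time through
the equations. -/
structure IsGlobalStrongSolution (Ω : Set E3) (K : ℝ) (F FΓ h : ℝ → ℝ)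
    (u₀ : H2Bulk Ω) (φ₀ : H2Surf Ω)
    (u : ℝ → H2Bulk Ω) (φ : ℝ → H2Surf Ω)
    (ut : ℝ → L2Bulk Ω) (φt : ℝ → L2Surf Ω) : Prop where
  continuous_bulk : ContinuousOn u (Ici 0)
  continuous_surf : ContinuousOn φ (Ici 0)
  timeDeriv_bulk : IsTimeDeriv (fun t => (u t).val) ut
  timeDeriv_surf : IsTimeDeriv (fun t => (φ t).val) φt
  initial_bulk : (u 0).val = u₀.val
  initial_surf : (φ 0).val = φ₀.val
  bulk_equation : ∀ t > 0, ∀ᵐ x ∂(bulkMeasure Ω),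
    ut t x - (u t).laplacian x + deriv F ((u t).val x) = 0
  boundary_equations : ∀ t > 0, ∃ d L : L2Surf Ω,
    RobinCondition K h (u t) (φ t).val d ∧ IsLaplaceBeltrami (φ t) L ∧
      ∀ᵐ x ∂(surfaceMeasure Ω),
        φt t x - L x + deriv FΓ ((φ t).val x) + deriv h ((φ t).val x) * d x = 0

end BulkSurfaceAC

end

open MeasureTheory Set Filter Topology
open scoped ContDiff

noncomputable section

/-! The system is the L²(Ω) × L²(Γ) gradient flow of the `energy` ½‖∇u‖² + ∫F(u) + ½‖∇_Γ φ‖² +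
∫F_Γ(φ) + (K/2)‖∂_ν u‖², whose last term equals ‖h(φ) − u‖²/(2K) on Γ by the Robin condition. Write
y = (u, φ) and w = ∂ₜy. The argument needs no compactness of the orbit and no bound uniform in time
beyond those given by the energy.

The central fact, `exists_energy_semiconvex`, is that −w(s) is a subgradient of the energy at y(s)
up to a quadratic error: E(t) ≥ E(s) − ⟪w(s), y(t) − y(s)⟫ − Λ(s)‖y(t) − y(s)‖², with Λ = C(1 + ‖∂_ν
u‖²). The potentials are semiconvex and the other quadratic terms convex; the only dangerous term is
∂_ν u times the Taylor remainder of h. It is controlled by ‖∂_ν u‖ ‖(δφ)²‖ in L²(Γ), where δφ is the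
increment of φ, hence by Ladyzhenskaya's inequality on Γ, and the gradient part is absorbed by the
strict convexity of ½‖∇_Γ φ‖². Since the energy dominates (K/2)‖∂_ν u‖² up to a constant
(`exists_energy_ge`), Λ is bounded on energy sublevels.

The rest is abstract (`tendsto_velocity_of_gradientFlow`). Semiconvexity gives E' = −‖w‖² almost
everywhere, so E decreases to a limit and Λ stays bounded by some C. Applied at two times in both
orders it gives ⟪w(t) − w(s), y(t) − y(s)⟫ ≤ 2C‖y(t) − y(s)‖²; thus time translates separate at most
exponentially, and in the limit ‖w(t)‖² ≤ e^{4C(t−s)}‖w(s)‖² for almost all s ≤ t. Averaging over s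
in (t − 1, t) bounds ‖w(t)‖² by a multiple of E(t − 1) − E(t), which tends to 0.

The conclusion concerns every t, while time derivatives are a.e. objects. The velocity fixed by the
equations at time t is therefore compared with its earlier essential bounds
(`norm_bulk_velocity_le`, `norm_surface_velocity_le`), using the continuity of (u, φ) in H² and of
∂_ν u in L²(Γ). On Γ this needs embeddings of H¹(Γ) for arbitrary powers, which come from
`IsSmoothBoundedDomain.gagliardoNirenberg`. -/

namespace BulkSurfaceAC

/-! ### Semiconvex gradient flows in a Hilbert space. -/

section AbstractFlow

open scoped RealInnerProductSpace

variable {H : Type*} [NormedAddCommGroup H] [InnerProductSpace ℝ H]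

/-- A real function that is Lipschitz on `[a, b]` and has a nonpositive derivative almost
everywhere does not increase from `a` to `b`. -/
lemma le_of_absolutelyContinuous_of_deriv_nonpos {g : ℝ → ℝ} {a b : ℝ} (hab : a ≤ b)
    (hg : AbsolutelyContinuousOnInterval g a b)
    (hd : ∀ᵐ x, x ∈ Ioc a b → deriv g x ≤ 0) : g b ≤ g a := by
  have h1 := hg.integral_deriv_eq_sub
  have h2 : ∫ x in a..b, deriv g x ≤ 0 := by
    rw [intervalIntegral.integral_of_le hab]
    refine integral_nonpos_of_ae ?_
    exact (ae_restrict_iff' measurableSet_Ioc).2 hd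
  linarith

/-- `y` is a primitive on `[0, ∞)` of the locally bounded function `w`. -/
lemma exists_lipschitz_of_timeDeriv {y w : ℝ → H} (hyw : IsTimeDeriv y w) {T : ℝ} (hT : 0 < T) :
    ∃ M : ℝ, 0 ≤ M ∧ (∀ᵐ s, s ∈ Ioc 0 T → ‖w s‖ ≤ M) ∧
      ∀ s ∈ Icc 0 T, ∀ t ∈ Icc 0 T, ‖y t - y s‖ ≤ M * |t - s| := by
  obtain ⟨hw, hy⟩ := hyw
  obtain ⟨hm, hb⟩ := hw T hT
  have hae : ∀ᵐ s, s ∈ Ioc 0 T → ‖w s‖ ≤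
      (eLpNorm w ⊤ (volume.restrict (Ioc 0 T))).toReal := by
    rw [← ae_restrict_iff' measurableSet_Ioc]
    filter_upwards [ae_le_eLpNormEssSup (f := w) (μ := volume.restrict (Ioc 0 T))] with s hs
    rw [← eLpNorm_exponent_top] at hs
    have := ENNReal.toReal_mono hb.ne hs
    simpa using this
  have hint : IntervalIntegrable w volume 0 T := by
    rw [intervalIntegrable_iff_integrableOn_Ioc_of_le hT.le]
    exact (hw T hT).integrable le_top
  refine ⟨_, ENNReal.toReal_nonneg, hae, fun s hs t ht => ?_⟩
  have hsub : y t - y s = ∫ r in s..t, w r := by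
    rw [hy t ht.1, hy s hs.1, add_sub_add_left_eq_sub]
    refine intervalIntegral.integral_interval_sub_left ?_ ?_ <;>
    · refine hint.mono_set ?_
      rw [uIcc_of_le hT.le]
      first
        | exact uIcc_subset_Icc (left_mem_Icc.2 hT.le) ht
        | exact uIcc_subset_Icc (left_mem_Icc.2 hT.le) hs
  rw [hsub]
  refine intervalIntegral.norm_integral_le_of_norm_le_const_ae ?_
  filter_upwards [hae] with r hr hr'
  refine hr ?_
  rw [uIoc, mem_Ioc] at hr'
  exact ⟨lt_of_le_of_lt (le_min hs.1 ht.1) hr'.1, hr'.2.trans (max_le hs.2 ht.2)⟩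

/-- Lebesgue differentiation on each interval [0, n + 1], combined over countably many n. -/
lemma ae_hasDerivAt_of_timeDeriv [CompleteSpace H] {y w : ℝ → H} (hyw : IsTimeDeriv y w) :
    ∀ᵐ t, 0 < t → HasDerivAt y (w t) t := by
  obtain ⟨hw, hy⟩ := hyw
  have hint : ∀ n : ℕ, IntervalIntegrable w volume 0 (n + 1) := fun n => by
    have hT : (0 : ℝ) < n + 1 := by positivity
    rw [intervalIntegrable_iff_integrableOn_Ioc_of_le hT.le]
    exact (hw _ hT).integrable le_top
  have := ae_all_iff.2 fun n : ℕ => (hint n).ae_hasDerivAt_integral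
  filter_upwards [this] with t ht h0
  obtain ⟨n, hn⟩ := exists_nat_gt t
  have h1 := ht n (by rw [uIcc_of_le (by positivity)]; exact ⟨h0.le, by linarith⟩) 0 (by simp)
  refine (h1.const_add (y 0)).congr_of_eventuallyEq ?_
  filter_upwards [lt_mem_nhds h0] with s hs
  exact hy s hs.le

/-- Decay of the velocity of a gradient flow: `E` is semiconvex along the trajectory with a modulus
`Λ` that is bounded on sublevel sets of `E`, and the velocity `w` is controlled at each time by its
essential bounds at earlier times. -/
theorem tendsto_velocity_of_gradientFlow [CompleteSpace H] {y w : ℝ → H} {E Λ : ℝ → ℝ} {C₀ : ℝ}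
    (hyw : IsTimeDeriv y w)
    (hE : ∀ s > 0, ∀ t > 0, E s - ⟪w s, y t - y s⟫ - Λ s * ‖y t - y s‖ ^ 2 ≤ E t)
    (hΛ : ∀ a b, 0 < a → ∃ C, ∀ s ∈ Icc a b, Λ s ≤ C)
    (hΛE : ∀ e, ∃ C, ∀ s > 0, E s ≤ e → Λ s ≤ C)
    (hEb : ∃ m, ∀ s > 0, m ≤ E s)
    (hlsc : ∀ t > 0, ∀ c ≥ 0, ∀ a ∈ Ico 0 t, (∀ᵐ s, s ∈ Ioo a t → ‖w s‖ ≤ c) → ‖w t‖ ≤ C₀ * c) :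
    Tendsto (fun t => ‖w t‖) atTop (𝓝 0) := by
  have hder := ae_hasDerivAt_of_timeDeriv hyw
  -- local Lipschitz bounds
  have hElip : ∀ a b, 0 < a → a ≤ b → ∃ C : ℝ, 0 ≤ C ∧
      ∀ s ∈ Icc a b, ∀ t ∈ Icc a b, |E t - E s| ≤ C * |t - s| := by
    intro a b ha hab
    have hb : 0 < b := ha.trans_le hab
    obtain ⟨M, hM0, hM, hlip⟩ := exists_lipschitz_of_timeDeriv hyw hb
    obtain ⟨C, hC⟩ := hΛ a b ha
    -- The essential bound for `w` becomes a bound at every time through `hlsc` with left end 0.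
    have hwb : ∀ t ∈ Icc a b, ‖w t‖ ≤ C₀ * M := fun t ht => by
      refine hlsc t (ha.trans_le ht.1) M hM0 0 ⟨le_rfl, ha.trans_le ht.1⟩ ?_
      filter_upwards [hM] with s hs hs'
      exact hs ⟨hs'.1, hs'.2.le.trans ht.2⟩
    have hone : ∀ s ∈ Icc a b, ∀ t ∈ Icc a b,
        E s - E t ≤ (|C₀ * M| * M + |C| * M * M * (b - a)) * |t - s| := by
      intro s hs t ht
      have h1 := hE s (ha.trans_le hs.1) t (ha.trans_le ht.1)
      have h2 := real_inner_le_norm (w s) (y t - y s)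
      have h3 := hlip s ⟨ha.le.trans hs.1, hs.2⟩ t ⟨ha.le.trans ht.1, ht.2⟩
      have h4 : ‖w s‖ * ‖y t - y s‖ ≤ |C₀ * M| * (M * |t - s|) :=
        mul_le_mul ((hwb s hs).trans (le_abs_self _)) h3 (norm_nonneg _) (abs_nonneg _)
      have h6 : |t - s| ≤ b - a := abs_sub_le_iff.2 ⟨by linarith [ht.2, hs.1], by linarith [hs.2, ht.1]⟩
      have h5 : Λ s * ‖y t - y s‖ ^ 2 ≤ |C| * ((M * |t - s|) * (M * (b - a))) := by
        refine mul_le_mul ((hC s hs).trans (le_abs_self _)) ?_ (sq_nonneg _) (abs_nonneg _)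
        rw [sq]
        exact mul_le_mul h3 (h3.trans (by gcongr)) (norm_nonneg _) (by positivity)
      nlinarith
    have hba : 0 ≤ b - a := sub_nonneg.2 hab
    refine ⟨|C₀ * M| * M + |C| * M * M * (b - a), by positivity, fun s hs t ht => ?_⟩
    rw [abs_sub_le_iff]
    refine ⟨?_, hone s hs t ht⟩
    have := hone t ht s hs
    rwa [abs_sub_comm s t] at this
  have hEac : ∀ a b, 0 < a → a ≤ b → AbsolutelyContinuousOnInterval E a b := by
    intro a b ha hab
    obtain ⟨C, hC0, hC⟩ := hElip a b ha hab
    refine LipschitzOnWith.absolutelyContinuousOnInterval (K := C.toNNReal) ?_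
    rw [uIcc_of_le hab]
    refine LipschitzOnWith.of_dist_le_mul fun s hs t ht => ?_
    rw [Real.coe_toNNReal _ hC0, Real.dist_eq, Real.dist_eq]
    exact hC t ht s hs
  -- dissipation identity
  have hEder : ∀ t > 0, HasDerivAt y (w t) t → DifferentiableAt ℝ E t →
      deriv E t = -‖w t‖ ^ 2 := by
    intro t ht hyt hEt
    -- Semiconvexity at base time t says that this function of s is minimal at s = t; its derivative
    -- there, E'(t) + ‖w t‖², must vanish.
    have hg : HasDerivAt (fun s => E s + ⟪w t, y s - y t⟫ + Λ t * ‖y s - y t‖ ^ 2)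
        (deriv E t + ⟪w t, w t⟫ + Λ t * (2 * ⟪y t - y t, w t⟫)) t := by
      have h1 : HasDerivAt (fun s => y s - y t) (w t) t := hyt.sub_const _
      have h2 := (hasDerivAt_const t (w t)).inner ℝ h1
      have h3 := h1.norm_sq
      convert! (hEt.hasDerivAt.add h2).add (h3.const_mul (Λ t)) using 1
      simp
    have hmin : IsLocalMin (fun s => E s + ⟪w t, y s - y t⟫ + Λ t * ‖y s - y t‖ ^ 2) t := by
      filter_upwards [lt_mem_nhds ht] with s hs
      have := hE t ht s hs
      simp only [sub_self, inner_zero_right, norm_zero]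
      linarith
    have := hmin.hasDerivAt_eq_zero hg
    simp only [sub_self, inner_zero_left, real_inner_self_eq_norm_sq] at this
    linarith
  have hdiss : ∀ a b, 0 < a → a ≤ b → ∫ t in a..b, ‖w t‖ ^ 2 = E a - E b := by
    intro a b ha hab
    have h1 := (hEac a b ha hab).integral_deriv_eq_sub
    have h2 : ∫ t in a..b, deriv E t = ∫ t in a..b, -‖w t‖ ^ 2 := by
      refine intervalIntegral.integral_congr_ae ?_
      filter_upwards [hder, (hEac a b ha hab).ae_differentiableAt] with t h3 h4 ht
      rw [uIoc_of_le hab] at ht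
      have ht0 := ha.trans ht.1
      exact hEder t ht0 (h3 ht0) (h4 (by rw [uIcc_of_le hab]; exact ⟨ht.1.le, ht.2⟩))
    rw [intervalIntegral.integral_neg] at h2
    linarith
  have hanti : ∀ a b, 0 < a → a ≤ b → E b ≤ E a := by
    intro a b ha hab
    have := hdiss a b ha hab
    have h0 : 0 ≤ ∫ t in a..b, ‖w t‖ ^ 2 :=
      intervalIntegral.integral_nonneg hab fun _ _ => sq_nonneg _
    linarith
  -- From time 1 on the trajectory stays in the sublevel E ≤ E(1), so one constant bounds the
  -- modulus.
  obtain ⟨C, hC0, hC⟩ : ∃ C : ℝ, 0 ≤ C ∧ ∀ s ≥ 1, Λ s ≤ C := by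
    obtain ⟨C, hC⟩ := hΛE (E 1)
    exact ⟨|C|, abs_nonneg _, fun s hs => (hC s (by linarith) (hanti 1 s one_pos hs)).trans
      (le_abs_self _)⟩
  -- growth of translates
  have hgrow : ∀ τ > 0, ∀ s t, 1 ≤ s → s ≤ t →
      ‖y (t + τ) - y t‖ ^ 2 ≤ Real.exp (4 * C * (t - s)) * ‖y (s + τ) - y s‖ ^ 2 := by
    intro τ hτ s t hs hst
    obtain ⟨M, hM0, -, hlip⟩ := exists_lipschitz_of_timeDeriv hyw (T := t + τ) (by linarith)
    have hN : AbsolutelyContinuousOnInterval (fun r => ‖y (r + τ) - y r‖) s t := by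
      refine LipschitzOnWith.absolutelyContinuousOnInterval (K := (2 * M).toNNReal) ?_
      rw [uIcc_of_le hst]
      refine LipschitzOnWith.of_dist_le_mul fun a ha b hb => ?_
      rw [Real.coe_toNNReal _ (by positivity), Real.dist_eq, Real.dist_eq]
      have h1 := hlip b ⟨by linarith [hb.1], by linarith [hb.2]⟩ a
        ⟨by linarith [ha.1], by linarith [ha.2]⟩
      have h2 := hlip (b + τ) ⟨by linarith [hb.1], by linarith [hb.2]⟩ (a + τ)
        ⟨by linarith [ha.1], by linarith [ha.2]⟩
      rw [add_sub_add_right_eq_sub] at h2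
      calc _ ≤ ‖(y (a + τ) - y a) - (y (b + τ) - y b)‖ := abs_norm_sub_norm_le _ _
        _ = ‖(y (a + τ) - y (b + τ)) - (y a - y b)‖ := by congr 1; abel
        _ ≤ _ := (norm_sub_le _ _).trans (by linarith)
    have hexp : AbsolutelyContinuousOnInterval (fun r => Real.exp (-(4 * C) * r)) s t := by
      refine ContDiffOn.absolutelyContinuousOnInterval ?_
      fun_prop
    have hgac := hexp.fun_mul (hN.fun_mul hN)
    have hd : ∀ᵐ r, r ∈ Ioc s t → deriv
        (fun r => Real.exp (-(4 * C) * r) * (‖y (r + τ) - y r‖ * ‖y (r + τ) - y r‖)) r ≤ 0 := by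
      have htr : ∀ᵐ r : ℝ, 0 < r + τ → HasDerivAt y (w (r + τ)) (r + τ) :=
        (measurePreserving_add_right volume τ).quasiMeasurePreserving.ae hder
      filter_upwards [hder, htr] with r h1 h2 hr
      have hr1 : 1 < r := hs.trans_lt hr.1
      have h3 : HasDerivAt (fun r => y (r + τ) - y r) (w (r + τ) - w r) r :=
        ((h2 (by linarith)).comp_add_const r τ).sub (h1 (by linarith))
      have h4 := h3.norm_sq
      have h5 : HasDerivAt (fun r => Real.exp (-(4 * C) * r))
          (Real.exp (-(4 * C) * r) * (-(4 * C))) r := by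
        simpa using ((hasDerivAt_id r).const_mul (-(4 * C))).exp
      have h6 := h5.mul h4
      have h7 : (fun r => Real.exp (-(4 * C) * r) * (‖y (r + τ) - y r‖ * ‖y (r + τ) - y r‖)) =
          (fun r => Real.exp (-(4 * C) * r)) * fun r => ‖y (r + τ) - y r‖ ^ 2 := by
        funext r; simp [sq]
      rw [h7, h6.deriv]
      have e1 := hE r (by linarith) (r + τ) (by linarith)
      have e2 := hE (r + τ) (by linarith) r (by linarith)
      rw [norm_sub_rev (y r), ← neg_sub (y (r + τ)) (y r), inner_neg_right] at e2
      have e3 := mul_le_mul_of_nonneg_right (hC r (by linarith)) (sq_nonneg ‖y (r + τ) - y r‖)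
      have e4 := mul_le_mul_of_nonneg_right (hC (r + τ) (by linarith))
        (sq_nonneg ‖y (r + τ) - y r‖)
      -- The sum of the two semiconvexity inequalities: the energies cancel. The derivative of the
      -- squared norm doubles this, hence the rate 4C.
      have e5 : ⟪y (r + τ) - y r, w (r + τ) - w r⟫ ≤ 2 * C * ‖y (r + τ) - y r‖ ^ 2 := by
        rw [real_inner_comm, inner_sub_left]
        linarith
      have e6 := Real.exp_pos (-(4 * C) * r)
      nlinarith
    have := le_of_absolutelyContinuous_of_deriv_nonpos hst hgac hd
    simp only [← sq] at this
    have e : Real.exp (4 * C * (t - s)) =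
        Real.exp (-(4 * C) * s) * (Real.exp (-(4 * C) * t))⁻¹ := by
      rw [← Real.exp_neg, ← Real.exp_add]; congr 1; ring
    rw [e, mul_comm (Real.exp (-(4 * C) * s)), mul_assoc, ← div_eq_inv_mul,
      le_div_iff₀ (Real.exp_pos _), mul_comm]
    exact this
  -- comparison of velocities at two times
  have hvel : ∀ s t, 1 ≤ s → s ≤ t → HasDerivAt y (w s) s → HasDerivAt y (w t) t →
      ‖w t‖ ^ 2 ≤ Real.exp (4 * C * (t - s)) * ‖w s‖ ^ 2 := by
    intro s t hs hst h1 h2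
    have lim : ∀ r, HasDerivAt y (w r) r → Tendsto (fun τ : ℝ => ‖τ⁻¹ • (y (r + τ) - y r)‖ ^ 2)
        (𝓝[>] 0) (𝓝 (‖w r‖ ^ 2)) := by
      intro r hr
      have := hr.tendsto_slope_zero.mono_left (nhdsGT_le_nhdsNE 0)
      exact (this.norm).pow 2
    refine le_of_tendsto_of_tendsto (lim t h2) ((lim s h1).const_mul _) ?_
    filter_upwards [self_mem_nhdsWithin] with τ hτ
    have := hgrow τ hτ s t hs hst
    rw [norm_smul, norm_smul, mul_pow, mul_pow, mul_left_comm]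
    gcongr
  -- `hvel` bounds the velocity on (s, t) almost everywhere by its value at s, and `hlsc` carries
  -- the bound to t itself. Integration over s in a unit interval then turns the right side into an
  -- energy drop by `hdiss`.
  have hpt : ∀ t ≥ 3, ‖w t‖ ^ 2 ≤ C₀ ^ 2 * Real.exp (4 * C) * (E (t - 1) - E t) := by
    intro t ht
    have hae : ∀ᵐ s, s ∈ Ioc (t - 1) t → ‖w t‖ ^ 2 ≤ C₀ ^ 2 * Real.exp (4 * C) * ‖w s‖ ^ 2 := by
      have hne : ∀ᵐ s : ℝ, s ≠ t := by simp [ae_iff, measure_singleton]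
      filter_upwards [hder, hne] with s h1 h2 hs
      have hst : s < t := lt_of_le_of_ne hs.2 h2
      have h3 : ‖w t‖ ≤ C₀ * Real.sqrt (Real.exp (4 * C) * ‖w s‖ ^ 2) := by
        refine hlsc t (by linarith) _ (Real.sqrt_nonneg _) s ⟨by linarith [hs.1], hst⟩ ?_
        filter_upwards [hder] with r h4 hr
        refine Real.le_sqrt_of_sq_le ?_
        have h5 := hvel s r (by linarith [hs.1]) hr.1.le (h1 (by linarith [hs.1]))
          (h4 (by linarith [hs.1, hr.1]))
        refine h5.trans (mul_le_mul_of_nonneg_right (Real.exp_le_exp.2 ?_) (sq_nonneg _))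
        nlinarith [hr.2, hs.1]
      calc ‖w t‖ ^ 2 ≤ (C₀ * Real.sqrt (Real.exp (4 * C) * ‖w s‖ ^ 2)) ^ 2 := by gcongr
        _ = _ := by rw [mul_pow, Real.sq_sqrt (by positivity)]; ring
    have hint : IntervalIntegrable (fun s => ‖w s‖ ^ 2) volume (t - 1) t := by
      rw [intervalIntegrable_iff_integrableOn_Ioc_of_le (by linarith)]
      have h1 := (hyw.1 t (by linarith)).mono_measure
        (Measure.restrict_mono (Ioc_subset_Ioc_left (show (0 : ℝ) ≤ t - 1 by linarith)) le_rfl)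
      have h2 : MemLp w 2 (volume.restrict (Ioc (t - 1) t)) := h1.mono_exponent le_top
      exact h2.integrable_norm_pow (by norm_num)
    have h1 : ∫ s in (t - 1)..t, ‖w t‖ ^ 2 ≤
        ∫ s in (t - 1)..t, C₀ ^ 2 * Real.exp (4 * C) * ‖w s‖ ^ 2 := by
      rw [intervalIntegral.integral_of_le (by linarith), intervalIntegral.integral_of_le (by linarith)]
      refine integral_mono_ae (by simp) ?_ ((ae_restrict_iff' measurableSet_Ioc).2 hae)
      exact ((intervalIntegrable_iff_integrableOn_Ioc_of_le (by linarith)).1 hint).const_mul _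
    rw [intervalIntegral.integral_const_mul, hdiss _ _ (by linarith) (by linarith)] at h1
    simpa using h1
  obtain ⟨m, hm⟩ := hEb
  have hlim : ∃ l, Tendsto (fun t => E (max t 1)) atTop (𝓝 l) := by
    refine ⟨_, tendsto_atTop_ciInf (f := fun t => E (max t 1)) ?_ ?_⟩
    · intro a b hab
      exact hanti _ _ (by positivity) (max_le_max_right _ hab)
    · exact ⟨m, by rintro _ ⟨t, rfl⟩; exact hm _ (by positivity)⟩
  obtain ⟨l, hl⟩ := hlim
  have hl1 : Tendsto E atTop (𝓝 l) := by
    refine hl.congr' ?_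
    filter_upwards [eventually_ge_atTop 1] with t ht
    rw [max_eq_left ht]
  have hl2 : Tendsto (fun t => E (t - 1)) atTop (𝓝 l) :=
    hl1.comp (tendsto_atTop_add_const_right _ (-1) tendsto_id)
  have hl3 : Tendsto (fun t => C₀ ^ 2 * Real.exp (4 * C) * (E (t - 1) - E t)) atTop (𝓝 0) := by
    simpa using (hl2.sub hl1).const_mul (C₀ ^ 2 * Real.exp (4 * C))
  have hl4 : Tendsto (fun t => ‖w t‖ ^ 2) atTop (𝓝 0) :=
    squeeze_zero' (Eventually.of_forall fun _ => sq_nonneg _)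
      (by filter_upwards [eventually_ge_atTop 3] with t ht using hpt t ht) hl3
  simpa [Real.sqrt_sq] using hl4.sqrt

end AbstractFlow

/-! ### Charts, surface measure and the Gagliardo–Nirenberg inequality on the boundary. -/

section Geometry

open scoped RealInnerProductSpace NNReal ENNReal

/-- Near a boundary point, the boundary of a smooth domain is the zero set of a defining function
without critical points. -/
lemma IsSmoothBoundedDomain.exists_definingFunction {Ω : Set E3} (hΩ : IsSmoothBoundedDomain Ω)
    {x : E3} (hx : x ∈ frontier Ω) :
    ∃ ρ : E3 → ℝ, ContDiff ℝ ∞ ρ ∧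
      ∀ᶠ y in 𝓝 x, fderiv ℝ ρ y ≠ 0 ∧ (y ∈ frontier Ω ↔ ρ y = 0) := by
  obtain ⟨ρ, hρ, hd, hloc⟩ := hΩ.smooth_boundary x hx
  refine ⟨ρ, hρ, ?_⟩
  have hcont : Continuous (fderiv ℝ ρ) := hρ.continuous_fderiv (by simp)
  filter_upwards [hcont.continuousAt.eventually_ne hd, hloc.eventually_nhds] with y h1 h2
  refine ⟨h1, ?_⟩
  have h3 := h2.self_of_nhds
  rw [hΩ.isOpen.frontier_eq]
  constructor
  · rintro ⟨hy1, hy2⟩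
    refine le_antisymm ?_ (not_lt.1 fun h => hy2 (h3.2 h))
    rw [mem_closure_iff_frequently] at hy1
    have : ∃ᶠ z in 𝓝 y, ρ z ≤ 0 := (hy1.and_eventually h2).mono fun z hz => (hz.2.1 hz.1).le
    exact isClosed_Iic.mem_of_frequently_of_tendsto this hρ.continuous.continuousAt
  · intro hy
    refine ⟨?_, fun h => (h3.1 h).ne hy⟩
    rw [mem_closure_iff_frequently]
    intro hcon
    -- A zero of ρ outside the closure of Ω would have ρ ≥ 0 all around it, hence be a critical
    -- point.
    have hmin : IsLocalMin ρ y := by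
      filter_upwards [hcon, h2] with z hz1 hz2
      rw [hy]
      exact not_lt.1 fun h => hz1 (hz2.2 h)
    exact h1 hmin.fderiv_eq_zero

/-- A local parametrization of the boundary over a plane `P`, with an affine left inverse. -/
lemma IsSmoothBoundedDomain.exists_chart {Ω : Set E3} (hΩ : IsSmoothBoundedDomain Ω)
    {x : E3} (hx : x ∈ frontier Ω) :
    ∃ P : Submodule ℝ E3, Module.finrank ℝ P = 2 ∧ ∃ (Φ : P → E3) (A : E3 →L[ℝ] P) (r : ℝ)
      (L : ℝ≥0), 0 < r ∧ Φ 0 = x ∧ (∀ y ∈ Metric.ball 0 r, ContDiffAt ℝ 1 Φ y) ∧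
      LipschitzOnWith L Φ (Metric.ball 0 r) ∧ (∀ y ∈ Metric.ball 0 r, Φ y ∈ frontier Ω) ∧
      (∀ y ∈ Metric.ball 0 r, A (Φ y - x) = y) ∧
      ∀ s, 0 < s → s ≤ r → Φ '' Metric.ball 0 s ∈ 𝓝[frontier Ω] x := by
  obtain ⟨ρ, hρ, hloc⟩ := hΩ.exists_definingFunction hx
  obtain ⟨hd, hρx⟩ := hloc.self_of_nhds
  have hρx : ρ x = 0 := hρx.1 hx
  set n := gradient ρ x with hn
  have hn0 : n ≠ 0 := by
    simpa [hn, gradient] using hd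
  have hinner : ∀ v, fderiv ℝ ρ x v = ⟪n, v⟫ := fun v => by
    rw [hn, gradient, InnerProductSpace.toDual_symm_apply]
  set P : Submodule ℝ E3 := (ℝ ∙ n)ᗮ with hP
  have hker : (fderiv ℝ ρ x).ker = P := by
    ext v
    rw [hP, Submodule.mem_orthogonal_singleton_iff_inner_right, LinearMap.mem_ker]
    exact Eq.congr_left (hinner v)
  have hfin : Module.finrank ℝ P = 2 := by
    have : Fact (Module.finrank ℝ E3 = 2 + 1) := ⟨by simp⟩
    exact Submodule.finrank_orthogonal_span_singleton hn0
  -- The pair (ρ, projection onto the tangent plane) is a local diffeomorphism; the chart is its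
  -- inverse restricted to ρ = 0, and the projection is the affine left inverse.
  let D : ImplicitFunctionData ℝ E3 ℝ P :=
    { leftFun := ρ
      leftDeriv := fderiv ℝ ρ x
      rightFun := fun z => P.orthogonalProjectionOnto (z - x)
      rightDeriv := P.orthogonalProjectionOnto
      pt := x
      hasStrictFDerivAt_leftFun := hρ.contDiffAt.hasStrictFDerivAt (by simp)
      hasStrictFDerivAt_rightFun := by
        simpa using! P.orthogonalProjectionOnto.hasStrictFDerivAt.comp x
          ((hasStrictFDerivAt_id x).sub_const x)
      range_leftDeriv := by
        rw [LinearMap.range_eq_top]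
        refine LinearMap.surjective (f := (fderiv ℝ ρ x : E3 →ₗ[ℝ] ℝ)) ?_
        intro h
        exact hd (ContinuousLinearMap.coe_injective h)
      range_rightDeriv := by
        rw [LinearMap.range_eq_top]
        intro v
        exact ⟨v, by simp⟩
      isCompl_ker := by
        rw [hker, Submodule.ker_orthogonalProjectionOnto]
        exact P.isCompl_orthogonal }
  let T := D.toOpenPartialHomeomorph
  have hTapp : ∀ z, T z = (ρ z, P.orthogonalProjectionOnto (z - x)) := fun z => rfl
  have hTx : T x = (0, 0) := by rw [hTapp]; simp [hρx]
  have hxs : x ∈ T.source := D.pt_mem_toOpenPartialHomeomorph_source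
  have h0t : ((0 : ℝ), (0 : P)) ∈ T.target := hTx ▸ T.map_source hxs
  have hsymm0 : T.symm (0, 0) = x := by rw [← hTx, T.left_inv hxs]
  have hTC : ContDiff ℝ ∞ T := by
    have : (T : E3 → ℝ × P) = fun z => (ρ z, P.orthogonalProjectionOnto (z - x)) := rfl
    rw [this]
    fun_prop
  have hSC : ContDiffAt ℝ 1 T.symm (0, 0) := by
    refine T.contDiffAt_symm h0t (f₀' := D.leftDeriv.equivProdOfSurjectiveOfIsCompl D.rightDeriv
      D.range_leftDeriv D.range_rightDeriv D.isCompl_ker) ?_ ?_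
    · rw [hsymm0]; exact D.hasStrictFDerivAt.hasFDerivAt
    · exact (hTC.of_le (by simp)).contDiffAt
  let Φ : P → E3 := fun y => T.symm (0, y)
  have hΦ0 : Φ 0 = x := hsymm0
  have hΦC : ContDiffAt ℝ 1 Φ 0 := by
    refine ContDiffAt.comp (0 : P) (g := T.symm) (f := fun y : P => ((0 : ℝ), y)) hSC ?_
    fun_prop
  obtain ⟨L, U, hU, hLip⟩ := hΦC.exists_lipschitzOnWith
  have hev1 : ∀ᶠ y in 𝓝 (0 : P), ContDiffAt ℝ 1 Φ y := hΦC.eventually (by simp)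
  have hpair : Tendsto (fun y : P => ((0 : ℝ), y)) (𝓝 0) (𝓝 (0, 0)) :=
    (by fun_prop : Continuous fun y : P => ((0 : ℝ), y)).tendsto 0
  have hev2 : ∀ᶠ y in 𝓝 (0 : P), ((0 : ℝ), y) ∈ T.target :=
    hpair.eventually (T.open_target.mem_nhds h0t)
  have hev3 : ∀ᶠ y in 𝓝 (0 : P), (Φ y ∈ frontier Ω ↔ ρ (Φ y) = 0) := by
    have : Tendsto Φ (𝓝 0) (𝓝 x) := by
      have := hΦC.continuousAt.tendsto
      rwa [hΦ0] at this
    exact this.eventually (hloc.mono fun y hy => hy.2)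
  obtain ⟨r, hr, hball⟩ := Metric.mem_nhds_iff.1 ((hev1.and (hev2.and hev3)).and hU)
  have hinv : ∀ y ∈ Metric.ball (0 : P) r, ρ (Φ y) = 0 ∧
      P.orthogonalProjectionOnto (Φ y - x) = y := by
    intro y hy
    have h1 := T.right_inv (hball hy).1.2.1
    rw [hTapp] at h1
    exact ⟨congrArg Prod.fst h1, congrArg Prod.snd h1⟩
  refine ⟨P, hfin, Φ, P.orthogonalProjectionOnto, r, L, hr, hΦ0, fun y hy => (hball hy).1.1,
    hLip.mono fun y hy => (hball hy).2, fun y hy => (hball hy).1.2.2.2 (hinv y hy).1,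
    fun y hy => (hinv y hy).2, fun s hs hsr => ?_⟩
  have hproj : Tendsto (fun z => P.orthogonalProjectionOnto (z - x)) (𝓝 x) (𝓝 0) := by
    have : Continuous fun z => P.orthogonalProjectionOnto (z - x) := by fun_prop
    simpa using this.tendsto x
  rw [mem_nhdsWithin_iff_eventually]
  filter_upwards [hloc, T.open_source.mem_nhds hxs,
    hproj.eventually (Metric.ball_mem_nhds 0 hs)] with z h1 h2 h3 hz
  refine ⟨_, h3, ?_⟩
  have h4 : T z = (0, P.orthogonalProjectionOnto (z - x)) := by rw [hTapp, h1.2.1 hz]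
  change T.symm _ = z
  rw [← h4, T.left_inv h2]

/-- A map into a set sends all vectors, by its derivative, to tangent vectors. -/
lemma fderiv_mem_tangentCone {V : Type*} [NormedAddCommGroup V] [NormedSpace ℝ V] {Φ : V → E3}
    {s : Set V} {Γ : Set E3} {y : V} (hs : s ∈ 𝓝 y) (hΦ : DifferentiableAt ℝ Φ y)
    (hmaps : MapsTo Φ s Γ) (v : V) : fderiv ℝ Φ y v ∈ tangentConeAt ℝ Γ (Φ y) := by
  have h1 := (hΦ.hasFDerivAt.hasFDerivWithinAt (s := s)).mapsTo_tangent_cone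
  refine tangentConeAt_mono hmaps.image_subset (h1 ?_)
  rw [tangentConeAt_of_mem_nhds hs]
  trivial

/-- Since ρ vanishes on the boundary, its derivative kills the tangent cone, which gives one
inclusion. Equality follows by dimension: the derivative of a chart is injective on a plane and has
tangential values. -/
lemma IsSmoothBoundedDomain.span_tangentCone {Ω : Set E3} (hΩ : IsSmoothBoundedDomain Ω)
    {ρ : E3 → ℝ} (hρ : ContDiff ℝ ∞ ρ) {x : E3} (hx : x ∈ frontier Ω) (hd : fderiv ℝ ρ x ≠ 0)
    (hloc : ∀ᶠ y in 𝓝 x, y ∈ frontier Ω ↔ ρ y = 0) :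
    Submodule.span ℝ (tangentConeAt ℝ (frontier Ω) x) = (ℝ ∙ gradient ρ x)ᗮ := by
  have hn0 : gradient ρ x ≠ 0 := by
    simpa [gradient] using hd
  have : Fact (Module.finrank ℝ E3 = 2 + 1) := ⟨by simp⟩
  have hfin : Module.finrank ℝ (ℝ ∙ gradient ρ x)ᗮ = 2 :=
    Submodule.finrank_orthogonal_span_singleton hn0
  refine Submodule.eq_of_le_of_finrank_le ?_ ?_
  · rw [Submodule.span_le]
    intro v hv
    have h1 : HasFDerivWithinAt ρ (fderiv ℝ ρ x) (frontier Ω) x :=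
      (hρ.differentiable (by simp) x).hasFDerivAt.hasFDerivWithinAt
    have h2 : HasFDerivWithinAt ρ (0 : E3 →L[ℝ] ℝ) (frontier Ω) x := by
      refine (hasFDerivWithinAt_const (0 : ℝ) x (frontier Ω)).congr_of_eventuallyEq ?_
        (hloc.self_of_nhds.1 hx)
      filter_upwards [mem_nhdsWithin_of_mem_nhds hloc, self_mem_nhdsWithin] with y hy hy'
      exact hy.1 hy'
    have h3 := h1.unique_on h2 hv
    rw [SetLike.mem_coe, Submodule.mem_orthogonal_singleton_iff_inner_right, gradient,
      InnerProductSpace.toDual_symm_apply]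
    exact h3
  · obtain ⟨P, hP, Φ, A, r, L, hr, hΦ0, hC, -, hmem, hA, -⟩ := hΩ.exists_chart hx
    have h0 : (0 : P) ∈ Metric.ball (0 : P) r := Metric.mem_ball_self hr
    have hdiff : DifferentiableAt ℝ Φ 0 := (hC 0 h0).differentiableAt (by simp)
    have hcomp : ∀ v, A (fderiv ℝ Φ 0 v) = v := by
      have h1 : HasFDerivAt (fun y => A (Φ y - x)) (A.comp (fderiv ℝ Φ 0)) 0 :=
        A.hasFDerivAt.comp 0 (hdiff.hasFDerivAt.sub_const x)
      have h2 : HasFDerivAt (fun y => A (Φ y - x)) (ContinuousLinearMap.id ℝ P) 0 := by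
        refine (hasFDerivAt_id (0 : P)).congr_of_eventuallyEq ?_
        filter_upwards [Metric.ball_mem_nhds (0 : P) hr] with y hy using hA y hy
      intro v
      exact congrArg (fun B : P →L[ℝ] P => B v) (h1.unique h2)
    have hinj : Function.Injective (fderiv ℝ Φ 0) := fun v w hvw => by
      rw [← hcomp v, hvw, hcomp w]
    have hle : (fderiv ℝ Φ 0 : P →ₗ[ℝ] E3).range ≤
        Submodule.span ℝ (tangentConeAt ℝ (frontier Ω) x) := by
      rintro _ ⟨v, rfl⟩
      refine Submodule.subset_span ?_
      have := fderiv_mem_tangentCone (Metric.ball_mem_nhds (0 : P) hr) hdiff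
        (fun y hy => hmem y hy) v
      rwa [hΦ0] at this
    have h3 := Submodule.finrank_mono hle
    rw [LinearMap.finrank_range_of_inj hinj, hP] at h3
    rwa [hfin]

/-- The explicit projection off ∇ρ is continuous wherever ∇ρ ≠ 0. This supplies the measurability
and boundedness of surface gradients of smooth functions. -/
lemma IsSmoothBoundedDomain.continuousOn_surfaceGradient {Ω : Set E3}
    (hΩ : IsSmoothBoundedDomain Ω) {ψ : E3 → ℝ} (hψ : ContDiff ℝ ∞ ψ) :
    ContinuousOn (surfaceGradient (frontier Ω) ψ) (frontier Ω) := by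
  have hgrad : ∀ {η : E3 → ℝ}, ContDiff ℝ ∞ η → Continuous (gradient η) := fun hη =>
    (InnerProductSpace.toDual ℝ E3).symm.continuous.comp (hη.continuous_fderiv (by simp))
  intro x hx
  obtain ⟨ρ, hρ, hloc⟩ := hΩ.exists_definingFunction hx
  have hn0 : gradient ρ x ≠ 0 := by
    simpa [gradient] using hloc.self_of_nhds.1
  have hev : ∀ᶠ y in 𝓝 x, y ∈ frontier Ω → surfaceGradient (frontier Ω) ψ y =
      gradient ψ y - (⟪gradient ρ y, gradient ψ y⟫ / ‖gradient ρ y‖ ^ 2) • gradient ρ y := by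
    filter_upwards [hloc, hloc.eventually_nhds] with y h1 h2 hy
    have := hΩ.span_tangentCone hρ hy h1.1 (h2.mono fun z hz => hz.2)
    have key : ∀ S : Submodule ℝ E3, S = (ℝ ∙ gradient ρ y)ᗮ → S.starProjection (gradient ψ y) =
        gradient ψ y - (⟪gradient ρ y, gradient ψ y⟫ / ‖gradient ρ y‖ ^ 2) • gradient ρ y := by
      rintro S rfl
      rw [Submodule.starProjection_orthogonal, sub_apply,
        Submodule.starProjection_singleton]
      simp
    exact key _ this
  have hc : ContinuousAt (fun y => gradient ψ y -
      (⟪gradient ρ y, gradient ψ y⟫ / ‖gradient ρ y‖ ^ 2) • gradient ρ y) x := by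
    have h1 : ContinuousAt (fun y => ⟪gradient ρ y, gradient ψ y⟫ / ‖gradient ρ y‖ ^ 2) x :=
      ((hgrad hρ).continuousAt.inner (hgrad hψ).continuousAt).div
        ((hgrad hρ).norm.pow 2).continuousAt (by simpa using hn0)
    exact (hgrad hψ).continuousAt.sub (h1.smul (hgrad hρ).continuousAt)
  refine hc.continuousWithinAt.congr_of_eventuallyEq ?_ (hev.self_of_nhds hx)
  filter_upwards [mem_nhdsWithin_of_mem_nhds hev, self_mem_nhdsWithin] with y h1 h2 using h1 h2

lemma euclideanHausdorffMeasure_image_le {X Y : Type*} [EMetricSpace X] [MeasurableSpace X]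
    [BorelSpace X] [EMetricSpace Y] [MeasurableSpace Y] [BorelSpace Y] {f : X → Y} {s : Set X}
    {L : ℝ≥0} (hf : LipschitzOnWith L f s) (d : ℕ) :
    μHE[d] (f '' s) ≤ (L : ℝ≥0∞) ^ d * μHE[d] s := by
  have := hf.hausdorffMeasure_image_le (d := d) (by positivity)
  simp only [Measure.euclideanHausdorffMeasure_def, Measure.smul_apply, ENNReal.smul_def,
    smul_eq_mul]
  rw [ENNReal.rpow_natCast] at this
  rw [mul_left_comm]
  gcongr

lemma volume_eq_euclideanHausdorffMeasure {P : Submodule ℝ E3} (hP : Module.finrank ℝ P = 2) :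
    (volume : Measure P) = μHE[2] := by
  rw [← InnerProductSpace.euclideanHausdorffMeasure_eq_volume, hP]

lemma IsSmoothBoundedDomain.isCompact_frontier {Ω : Set E3} (hΩ : IsSmoothBoundedDomain Ω) :
    IsCompact (frontier Ω) :=
  Metric.isCompact_of_isClosed_isBounded isClosed_frontier
    (hΩ.isBounded.closure.subset frontier_subset_closure)

lemma IsSmoothBoundedDomain.isFiniteMeasure_surface {Ω : Set E3} (hΩ : IsSmoothBoundedDomain Ω) :
    IsFiniteMeasure (surfaceMeasure Ω) := by
  refine ⟨?_⟩
  rw [surfaceMeasure, Measure.restrict_apply_univ]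
  refine hΩ.isCompact_frontier.measure_lt_top_of_nhdsWithin fun x hx => ?_
  obtain ⟨P, hP, Φ, A, r, L, hr, hΦ0, hC, hLip, hmem, hA, hnhds⟩ := hΩ.exists_chart hx
  refine ⟨_, hnhds r hr le_rfl, (euclideanHausdorffMeasure_image_le hLip 2).trans_lt ?_⟩
  rw [← volume_eq_euclideanHausdorffMeasure hP]
  exact ENNReal.mul_lt_top (by simp) measure_ball_lt_top

lemma IsSmoothBoundedDomain.isFiniteMeasure_bulk {Ω : Set E3} (hΩ : IsSmoothBoundedDomain Ω) :
    IsFiniteMeasure (bulkMeasure Ω) :=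
  ⟨by rw [bulkMeasure, Measure.restrict_apply_univ]; exact hΩ.isBounded.measure_lt_top⟩

lemma aestronglyMeasurable_of_continuousOn_frontier {Ω : Set E3} {X : Type*} [TopologicalSpace X]
    [TopologicalSpace.PseudoMetrizableSpace X] {v : E3 → X}
    [SecondCountableTopologyEither E3 X] (hv : ContinuousOn v (frontier Ω)) :
    AEStronglyMeasurable v (surfaceMeasure Ω) :=
  hv.aestronglyMeasurable isClosed_frontier.measurableSet

/-- Continuous functions on the boundary are bounded, hence in every `Lᵖ`. -/
lemma IsSmoothBoundedDomain.memLp_of_continuousOn {Ω : Set E3} (hΩ : IsSmoothBoundedDomain Ω)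
    {X : Type*} [NormedAddCommGroup X] {v : E3 → X} (hv : ContinuousOn v (frontier Ω))
    (p : ℝ≥0∞) : MemLp v p (surfaceMeasure Ω) := by
  have := hΩ.isFiniteMeasure_surface
  obtain ⟨C, hC⟩ := hΩ.isCompact_frontier.exists_bound_of_continuousOn hv
  refine MemLp.of_bound (aestronglyMeasurable_of_continuousOn_frontier hv) C ?_
  exact (ae_restrict_iff' isClosed_frontier.measurableSet).2 (.of_forall hC)

/-- The Gagliardo--Nirenberg--Sobolev inequality `W^{1,1} ⊂ L²` on a plane. -/
lemma exists_eLpNorm_two_le_fderiv {P : Submodule ℝ E3} (hP : Module.finrank ℝ P = 2) :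
    ∃ C : ℝ≥0, ∀ g : P → ℝ, ContDiff ℝ 1 g → HasCompactSupport g →
      eLpNorm g 2 volume ≤ C * eLpNorm (fderiv ℝ g) 1 volume := by
  refine ⟨eLpNormLESNormFDerivOneConst (volume : Measure P) ((2 : ℝ≥0) : ℝ), fun g hg hg' => ?_⟩
  have := eLpNorm_le_eLpNorm_fderiv_one (volume : Measure P) hg hg' (p := 2)
    (by rw [hP]; exact ⟨by norm_num, by norm_num, by norm_num⟩)
  exact this

lemma exists_cutoff {V : Type*} [NormedAddCommGroup V] [InnerProductSpace ℝ V]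
    [FiniteDimensional ℝ V] {r : ℝ} (hr : 0 < r) :
    ∃ χ : V → ℝ, ContDiff ℝ 1 χ ∧ HasCompactSupport χ ∧ tsupport χ ⊆ Metric.ball 0 r ∧
      (∀ y ∈ Metric.ball 0 (r / 2), χ y = 1) ∧ (∀ y, ‖χ y‖ ≤ 1) ∧
      ∃ M : ℝ≥0, ∀ y, ‖fderiv ℝ χ y‖ ≤ M := by
  let χ : ContDiffBump (0 : V) := ⟨r / 2, 3 * r / 4, by positivity, by linarith⟩
  have hχC : ContDiff ℝ 1 χ := χ.contDiff
  obtain ⟨M, hM⟩ : ∃ M, ∀ y, ‖fderiv ℝ χ y‖ ≤ M :=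
    (hχC.continuous_fderiv (by simp)).bounded_above_of_compact_support
      (χ.hasCompactSupport.fderiv ℝ)
  refine ⟨χ, hχC, χ.hasCompactSupport, ?_,
    fun y hy => χ.one_of_mem_closedBall (Metric.ball_subset_closedBall hy),
    fun y => by rw [Real.norm_of_nonneg χ.nonneg]; exact χ.le_one,
    M.toNNReal, fun y => (hM y).trans (Real.le_coe_toNNReal M)⟩
  rw [χ.tsupport_eq]
  exact Metric.closedBall_subset_ball (by change 3 * r / 4 < r; linarith)

/-- The surface measure and the Lebesgue measure of a chart are comparable. -/
lemma IsSmoothBoundedDomain.exists_chart_measure {Ω : Set E3} (hΩ : IsSmoothBoundedDomain Ω)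
    {x : E3} (hx : x ∈ frontier Ω) :
    ∃ P : Submodule ℝ E3, Module.finrank ℝ P = 2 ∧ ∃ (Φ : P → E3) (r : ℝ) (L D : ℝ≥0), 0 < r ∧
      (∀ y ∈ Metric.ball 0 r, ContDiffAt ℝ 1 Φ y) ∧ LipschitzOnWith L Φ (Metric.ball 0 r) ∧
      (∀ y ∈ Metric.ball 0 r, Φ y ∈ frontier Ω) ∧
      Φ '' Metric.ball 0 (r / 2) ∈ 𝓝[frontier Ω] x ∧
      (μHE[2] : Measure E3).restrict (Φ '' Metric.ball 0 (r / 2)) ≤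
        ((L : ℝ≥0∞) ^ 2) • (volume.restrict (Metric.ball 0 (r / 2))).map Φ ∧
      (volume.restrict (Metric.ball 0 r)).map Φ ≤ (D : ℝ≥0∞) • surfaceMeasure Ω := by
  obtain ⟨P, hP, Φ, A, r, L, hr, hΦ0, hC, hLip, hmem, hA, hnhds⟩ := hΩ.exists_chart hx
  have hvol := volume_eq_euclideanHausdorffMeasure hP
  set B := Metric.ball (0 : P) (r / 2)
  set V := Metric.ball (0 : P) r
  have hBV : B ⊆ V := Metric.ball_subset_ball (by linarith)
  have hVm : MeasurableSet V := measurableSet_ball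
  have hBm : MeasurableSet B := measurableSet_ball
  have hΦV : AEMeasurable Φ (volume.restrict V) := hLip.continuousOn.aemeasurable hVm
  have hΦB : AEMeasurable Φ (volume.restrict B) :=
    (hLip.continuousOn.mono hBV).aemeasurable hBm
  refine ⟨P, hP, Φ, r, L, ‖A‖₊ ^ 2, hr, hC, hLip, hmem,
    hnhds (r / 2) (by positivity) (by linarith), ?_, ?_⟩
  · refine Measure.le_iff.2 fun S hS => ?_
    rw [Measure.smul_apply, smul_eq_mul, Measure.map_apply_of_aemeasurable hΦB hS,
      Measure.restrict_apply hS, Measure.restrict_apply' hBm]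
    have h1 : S ∩ Φ '' B = Φ '' (Φ ⁻¹' S ∩ B) := by rw [image_preimage_inter]
    rw [h1, hvol]
    exact euclideanHausdorffMeasure_image_le (hLip.mono (inter_subset_right.trans hBV)) 2
  · rw [ENNReal.coe_pow]
    refine Measure.le_iff.2 fun S hS => ?_
    rw [Measure.smul_apply, smul_eq_mul, Measure.map_apply_of_aemeasurable hΦV hS,
      surfaceMeasure, Measure.restrict_apply hS, Measure.restrict_apply' hVm, hvol]
    -- The Lipschitz left inverse of the chart prevents it from shrinking measure by more than a
    -- factor.
    have hAlip : LipschitzWith ‖A‖₊ fun z => A (z - x) :=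
      LipschitzWith.of_dist_le_mul fun a b => by
        rw [dist_eq_norm, ← map_sub, sub_sub_sub_cancel_right, dist_eq_norm]
        exact A.le_opNorm _
    refine (measure_mono ?_).trans
      (euclideanHausdorffMeasure_image_le (hAlip.lipschitzOnWith (s := S ∩ frontier Ω)) 2)
    rintro y ⟨hy1, hy2⟩
    exact ⟨Φ y, ⟨hy1, hmem y hy2⟩, hA y hy2⟩

lemma enorm_fderiv_eq_zero {V : Type*} [NormedAddCommGroup V] [NormedSpace ℝ V] {g : V → ℝ}
    {y : V} (hg : g =ᶠ[𝓝 y] 0) : ‖fderiv ℝ g y‖ₑ = 0 := by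
  rw [hg.fderiv_eq, ← ofReal_norm]
  simp

/-- The derivative of the chart Φ takes tangential values, so the chain rule for v ∘ Φ sees only the
surface gradient of v; the product rule adds the cutoff term. -/
lemma norm_fderiv_mul_comp_le {V : Type*} [NormedAddCommGroup V] [NormedSpace ℝ V] {Φ : V → E3}
    {s : Set V} {Γ : Set E3} {y : V} {L M : ℝ≥0} {χ : V → ℝ} {v : E3 → ℝ} (hs : s ∈ 𝓝 y)
    (hLip : LipschitzOnWith L Φ s) (hmaps : ∀ z ∈ s, Φ z ∈ Γ) (hΦd : DifferentiableAt ℝ Φ y)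
    (hχ : DifferentiableAt ℝ χ y) (hχle : ‖χ y‖ ≤ 1) (hM : ‖fderiv ℝ χ y‖ ≤ M)
    (hvd : DifferentiableAt ℝ v (Φ y)) :
    ‖fderiv ℝ (fun y => χ y * v (Φ y)) y‖ ≤
      ((M + L : ℝ≥0) : ℝ) * (‖v (Φ y)‖ + ‖surfaceGradient Γ v (Φ y)‖) := by
  have h1 : fderiv ℝ (fun y => v (Φ y)) y = (fderiv ℝ v (Φ y)).comp (fderiv ℝ Φ y) :=
    fderiv_comp y hvd hΦd
  have h2 : ‖fderiv ℝ (fun y => v (Φ y)) y‖ ≤ L * ‖surfaceGradient Γ v (Φ y)‖ := by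
    rw [h1]
    refine ContinuousLinearMap.opNorm_le_bound _ (by positivity) fun w => ?_
    have h3 : fderiv ℝ Φ y w ∈ Submodule.span ℝ (tangentConeAt ℝ Γ (Φ y)) :=
      Submodule.subset_span (fderiv_mem_tangentCone hs hΦd hmaps w)
    have h4 : (fderiv ℝ v (Φ y)).comp (fderiv ℝ Φ y) w =
        ⟪surfaceGradient Γ v (Φ y), fderiv ℝ Φ y w⟫ := by
      rw [surfaceGradient, Submodule.inner_starProjection_left_eq_right,
        Submodule.starProjection_eq_self_iff.2 h3, gradient,
        InnerProductSpace.toDual_symm_apply]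
      rfl
    rw [h4]
    refine (norm_inner_le_norm _ _).trans ?_
    have h5 : ‖fderiv ℝ Φ y w‖ ≤ L * ‖w‖ :=
      ((fderiv ℝ Φ y).le_opNorm w).trans
        (mul_le_mul_of_nonneg_right (norm_fderiv_le_of_lipschitzOn ℝ hs hLip) (norm_nonneg _))
    calc _ ≤ ‖surfaceGradient Γ v (Φ y)‖ * (L * ‖w‖) := by gcongr
      _ = _ := by ring
  have h3 : fderiv ℝ (fun y => χ y * v (Φ y)) y =
      χ y • fderiv ℝ (fun y => v (Φ y)) y + v (Φ y) • fderiv ℝ χ y :=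
    fderiv_fun_mul hχ (hvd.comp y hΦd)
  rw [h3]
  refine (norm_add_le _ _).trans ?_
  rw [norm_smul, norm_smul, NNReal.coe_add]
  have h5 := mul_le_mul hχle h2 (norm_nonneg _) zero_le_one
  have h6 := mul_le_mul_of_nonneg_left hM (norm_nonneg (v (Φ y)))
  have h7 : 0 ≤ (M : ℝ) * ‖surfaceGradient Γ v (Φ y)‖ := by positivity
  have h8 : 0 ≤ (L : ℝ) * ‖v (Φ y)‖ := by positivity
  nlinarith

/-- A local form of the Gagliardo--Nirenberg inequality on the boundary. -/
lemma IsSmoothBoundedDomain.gagliardoNirenberg_local {Ω : Set E3} (hΩ : IsSmoothBoundedDomain Ω)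
    {x : E3} (hx : x ∈ frontier Ω) :
    ∃ U ∈ 𝓝[frontier Ω] x, ∃ C : ℝ≥0, ∀ v : E3 → ℝ, ContDiff ℝ ∞ v →
      eLpNorm v 2 ((μHE[2] : Measure E3).restrict U) ≤ C * (eLpNorm v 1 (surfaceMeasure Ω) +
        eLpNorm (surfaceGradient (frontier Ω) v) 1 (surfaceMeasure Ω)) := by
  obtain ⟨P, hP, Φ, r, L, D, hr, hC, hLip, hmem, hnhds, hle1, hle2⟩ := hΩ.exists_chart_measure hx
  set B := Metric.ball (0 : P) (r / 2)
  set V := Metric.ball (0 : P) r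
  have hBV : B ⊆ V := Metric.ball_subset_ball (by linarith)
  have hVm : MeasurableSet V := measurableSet_ball
  have hBm : MeasurableSet B := measurableSet_ball
  have hΦV : AEMeasurable Φ (volume.restrict V) := hLip.continuousOn.aemeasurable hVm
  have hΦB : AEMeasurable Φ (volume.restrict B) :=
    (hLip.continuousOn.mono hBV).aemeasurable hBm
  obtain ⟨χ, hχC, hχc, hχsupp, hχone, hχle, M, hM⟩ := exists_cutoff (V := P) hr
  obtain ⟨C₂, hsob⟩ := exists_eLpNorm_two_le_fderiv hP
  refine ⟨Φ '' B, hnhds, L * (C₂ * ((M + L) * D)), fun v hv => ?_⟩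
  -- The chart is controlled only on the ball `V`; the cutoff makes g a compactly supported C¹
  -- function on the whole plane, to which the planar Sobolev inequality applies.
  set g : P → ℝ := fun y => χ y * v (Φ y) with hg
  have hgV : ∀ y ∈ V, ContDiffAt ℝ 1 g y := fun y hy =>
    hχC.contDiffAt.mul (ContDiffAt.comp y (hv.of_le (by simp)).contDiffAt (hC y hy))
  have hg0 : ∀ y ∉ V, g =ᶠ[𝓝 y] 0 := fun y hy => by
    have : (tsupport χ)ᶜ ∈ 𝓝 y :=
      (isClosed_tsupport χ).isOpen_compl.mem_nhds fun h => hy (hχsupp h)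
    filter_upwards [this] with z hz
    simp [hg, image_eq_zero_of_notMem_tsupport hz]
  have hgC : ContDiff ℝ 1 g := by
    rw [contDiff_iff_contDiffAt]
    intro y
    by_cases hy : y ∈ V
    · exact hgV y hy
    · exact contDiffAt_const.congr_of_eventuallyEq (hg0 y hy)
  have hgsupp : HasCompactSupport g := hχc.mul_right
  have hderiv : ∀ y ∈ V, ‖fderiv ℝ g y‖ ≤
      ((M + L : ℝ≥0) : ℝ) * (‖v (Φ y)‖ + ‖surfaceGradient (frontier Ω) v (Φ y)‖) := fun y hy =>
    norm_fderiv_mul_comp_le (Metric.isOpen_ball.mem_nhds hy) hLip hmem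
      ((hC y hy).differentiableAt (by simp)) (hχC.differentiable (by simp) y) (hχle y) (hM y)
      (hv.differentiable (by simp) _)
  have hmeasG : AEStronglyMeasurable (surfaceGradient (frontier Ω) v) (surfaceMeasure Ω) :=
    aestronglyMeasurable_of_continuousOn_frontier (hΩ.continuousOn_surfaceGradient hv)
  -- Needed to pull a.e. measurability of the surface gradient back through the chart.
  have hac : (volume.restrict V).map Φ ≪ surfaceMeasure Ω :=
    (Measure.absolutelyContinuous_of_le hle2).trans Measure.smul_absolutelyContinuous
  have hder : eLpNorm (fderiv ℝ g) 1 volume ≤ ((M + L : ℝ≥0) : ℝ≥0∞) *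
      ((D : ℝ≥0∞) * (eLpNorm v 1 (surfaceMeasure Ω) +
        eLpNorm (surfaceGradient (frontier Ω) v) 1 (surfaceMeasure Ω))) := by
    have h1 : eLpNorm (fderiv ℝ g) 1 volume = ∫⁻ y in V, ‖fderiv ℝ g y‖ₑ := by
      rw [eLpNorm_one_eq_lintegral_enorm, setLIntegral_eq_of_support_subset]
      intro y hy
      by_contra h
      apply hy
      exact enorm_fderiv_eq_zero (hg0 y h)
    have h2 : ∫⁻ y in V, ‖fderiv ℝ g y‖ₑ ≤ ∫⁻ y in V, ((M + L : ℝ≥0) : ℝ≥0∞) *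
        (‖v (Φ y)‖ₑ + ‖surfaceGradient (frontier Ω) v (Φ y)‖ₑ) := by
      refine setLIntegral_mono_ae' hVm (.of_forall fun y hy => ?_)
      simp only [enorm]
      rw [← ENNReal.coe_add, ← ENNReal.coe_mul, ENNReal.coe_le_coe, ← NNReal.coe_le_coe]
      simpa using hderiv y hy
    have hmv : AEMeasurable (fun z => ‖v z‖ₑ) (surfaceMeasure Ω) :=
      hv.continuous.enorm.aemeasurable
    have h3 : ∫⁻ y in V, (‖v (Φ y)‖ₑ + ‖surfaceGradient (frontier Ω) v (Φ y)‖ₑ) =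
        ∫⁻ z, (‖v z‖ₑ + ‖surfaceGradient (frontier Ω) v z‖ₑ) ∂(volume.restrict V).map Φ := by
      exact (lintegral_map' (f := fun z => ‖v z‖ₑ + ‖surfaceGradient (frontier Ω) v z‖ₑ)
        ((hmv.add hmeasG.enorm).mono_ac hac) hΦV).symm
    rw [h1]
    refine h2.trans ?_
    rw [lintegral_const_mul' _ _ ENNReal.coe_ne_top, h3]
    gcongr
    refine (lintegral_mono' hle2 le_rfl).trans ?_
    rw [lintegral_smul_measure, lintegral_add_left' hmv, eLpNorm_one_eq_lintegral_enorm,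
      eLpNorm_one_eq_lintegral_enorm, smul_eq_mul]
  have hL2 : eLpNorm v 2 ((μHE[2] : Measure E3).restrict (Φ '' B)) ≤ L * eLpNorm g 2 volume := by
    calc _ ≤ eLpNorm v 2 (((L : ℝ≥0∞) ^ 2) • (volume.restrict B).map Φ) :=
          eLpNorm_mono_measure _ hle1
      _ = L * eLpNorm v 2 ((volume.restrict B).map Φ) := by
          rw [eLpNorm_smul_measure_of_ne_top (by simp), smul_eq_mul]
          congr 1
          rw [← ENNReal.rpow_natCast, ← ENNReal.rpow_mul]
          norm_num
      _ = L * eLpNorm (v ∘ Φ) 2 (volume.restrict B) := by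
          rw [eLpNorm_map_measure hv.continuous.aestronglyMeasurable hΦB]
      _ = L * eLpNorm g 2 (volume.restrict B) := by
          congr 1
          refine eLpNorm_congr_ae ((ae_restrict_iff' hBm).2 (.of_forall fun y hy => ?_))
          simp [hg, hχone y hy]
      _ ≤ _ := by
          gcongr
          exact Measure.restrict_le_self
  refine hL2.trans ?_
  have hsob' := hsob g hgC hgsupp
  calc _ ≤ (L : ℝ≥0∞) * (C₂ * eLpNorm (fderiv ℝ g) 1 volume) := by gcongr
    _ ≤ _ := by
      grw [hder]
      refine le_of_eq ?_
      push_cast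
      ring

/-- The Gagliardo--Nirenberg inequality `W^{1,1} ⊂ L²` on the boundary surface. -/
theorem IsSmoothBoundedDomain.gagliardoNirenberg {Ω : Set E3} (hΩ : IsSmoothBoundedDomain Ω) :
    ∃ C : ℝ≥0, ∀ v : E3 → ℝ, ContDiff ℝ ∞ v →
      eLpNorm v 2 (surfaceMeasure Ω) ≤ C * (eLpNorm v 1 (surfaceMeasure Ω) +
        eLpNorm (surfaceGradient (frontier Ω) v) 1 (surfaceMeasure Ω)) := by
  -- The left side is localized to a set while the right side stays global, so the property passes
  -- to subsets and finite unions.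
  refine hΩ.isCompact_frontier.induction_on (p := fun S => ∃ C : ℝ≥0, ∀ v : E3 → ℝ,
    ContDiff ℝ ∞ v → eLpNorm v 2 ((μHE[2] : Measure E3).restrict S) ≤
      C * (eLpNorm v 1 (surfaceMeasure Ω) +
        eLpNorm (surfaceGradient (frontier Ω) v) 1 (surfaceMeasure Ω))) ?_ ?_ ?_ ?_
  · exact ⟨0, fun v _ => by simp⟩
  · rintro S T hST ⟨C, hC⟩
    exact ⟨C, fun v hv =>
      (eLpNorm_mono_measure _ (Measure.restrict_mono hST le_rfl)).trans (hC v hv)⟩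
  · rintro S T ⟨C, hC⟩ ⟨D, hD⟩
    refine ⟨C + D, fun v hv => ?_⟩
    have hunion : eLpNorm v 2 ((μHE[2] : Measure E3).restrict (S ∪ T)) ≤
        eLpNorm v 2 ((μHE[2] : Measure E3).restrict S) +
          eLpNorm v 2 ((μHE[2] : Measure E3).restrict T) := by
      refine (eLpNorm_mono_measure _ (Measure.restrict_union_le S T)).trans ?_
      rw [eLpNorm_eq_lintegral_rpow_enorm_toReal (by simp) (by simp),
        eLpNorm_eq_lintegral_rpow_enorm_toReal (by simp) (by simp),
        eLpNorm_eq_lintegral_rpow_enorm_toReal (by simp) (by simp), lintegral_add_measure]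
      exact ENNReal.rpow_add_le_add_rpow _ _ (by norm_num) (by norm_num)
    refine hunion.trans ((add_le_add (hC v hv) (hD v hv)).trans (le_of_eq ?_))
    rw [ENNReal.coe_add, add_mul]
  · intro x hx
    exact hΩ.gagliardoNirenberg_local hx

end Geometry

/-! ### Scalar Taylor and growth estimates. -/

section Scalar

lemma exists_mem_uIcc_sub_eq_deriv_mul {F : ℝ → ℝ} (hF : Differentiable ℝ F) (a b : ℝ) :
    ∃ ξ ∈ uIcc a b, F b - F a = deriv F ξ * (b - a) := by
  rcases lt_trichotomy a b with h | h | h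
  · obtain ⟨ξ, hξ, h1⟩ := exists_deriv_eq_slope F h hF.continuous.continuousOn hF.differentiableOn
    refine ⟨ξ, ?_, ?_⟩
    · rw [uIcc_of_le h.le]; exact Ioo_subset_Icc_self hξ
    · rw [h1, div_mul_cancel₀ _ (sub_pos.2 h).ne']
  · subst h
    exact ⟨a, by simp, by simp⟩
  · obtain ⟨ξ, hξ, h1⟩ := exists_deriv_eq_slope F h hF.continuous.continuousOn hF.differentiableOn
    refine ⟨ξ, ?_, ?_⟩
    · rw [uIcc_of_ge h.le]; exact Ioo_subset_Icc_self hξ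
    · rw [h1, ← neg_sub a b, mul_neg, div_mul_cancel₀ _ (sub_pos.2 h).ne']
      ring

lemma abs_sub_le_of_mem_uIcc {a b ξ : ℝ} (h : ξ ∈ uIcc a b) : |ξ - a| ≤ |b - a| :=
  abs_sub_left_of_mem_uIcc h

lemma iteratedDeriv_two_eq (F : ℝ → ℝ) : iteratedDeriv 2 F = deriv (deriv F) := by
  rw [iteratedDeriv_succ, iteratedDeriv_one]

lemma iteratedDeriv_three_eq (F : ℝ → ℝ) : iteratedDeriv 3 F = deriv (deriv (deriv F)) := by
  rw [iteratedDeriv_succ, iteratedDeriv_two_eq]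

lemma differentiable_of_analyticOnNhd {F : ℝ → ℝ} (hF : AnalyticOnNhd ℝ F univ) :
    Differentiable ℝ F := fun x => (hF x trivial).differentiableAt

/-- The remainder of the first order Taylor expansion. -/
lemma exists_taylor_remainder {F : ℝ → ℝ} (hF : AnalyticOnNhd ℝ F univ) (a b : ℝ) :
    ∃ η θ : ℝ, 0 ≤ θ ∧ θ ≤ (b - a) ^ 2 ∧
      F b - F a - deriv F a * (b - a) = iteratedDeriv 2 F η * θ := by
  obtain ⟨ξ, hξ, h1⟩ := exists_mem_uIcc_sub_eq_deriv_mul (differentiable_of_analyticOnNhd hF) a b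
  obtain ⟨η, -, h2⟩ := exists_mem_uIcc_sub_eq_deriv_mul
    (differentiable_of_analyticOnNhd hF.deriv) a ξ
  refine ⟨η, (ξ - a) * (b - a), ?_, ?_, ?_⟩
  · rcases le_total a b with h | h
    · rw [uIcc_of_le h] at hξ
      exact mul_nonneg (sub_nonneg.2 hξ.1) (sub_nonneg.2 h)
    · rw [uIcc_of_ge h] at hξ
      exact mul_nonneg_of_nonpos_of_nonpos (sub_nonpos.2 hξ.2) (sub_nonpos.2 h)
  · calc (ξ - a) * (b - a) ≤ |ξ - a| * |b - a| := by rw [← abs_mul]; exact le_abs_self _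
      _ ≤ |b - a| * |b - a| :=
        mul_le_mul_of_nonneg_right (abs_sub_le_of_mem_uIcc hξ) (abs_nonneg _)
      _ = (b - a) ^ 2 := by rw [abs_mul_abs_self, sq]
  · rw [h1, iteratedDeriv_two_eq, ← mul_assoc, ← h2]
    ring

/-- The constant is c and not c/2 because the remainder comes from two applications of the mean
value theorem. -/
lemma semiconvex_le {F : ℝ → ℝ} (hF : AnalyticOnNhd ℝ F univ) {c : ℝ} (hc : 0 ≤ c)
    (h : ∀ s, -c ≤ iteratedDeriv 2 F s) (a b : ℝ) :
    F a + deriv F a * (b - a) - c * (b - a) ^ 2 ≤ F b := by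
  obtain ⟨η, θ, h0, h1, h2⟩ := exists_taylor_remainder hF a b
  nlinarith [h η]

lemma abs_taylor_remainder_le {F : ℝ → ℝ} (hF : AnalyticOnNhd ℝ F univ) {M : ℝ} (hM : 0 ≤ M)
    (h : ∀ s, |iteratedDeriv 2 F s| ≤ M) (a b : ℝ) :
    |F b - F a - deriv F a * (b - a)| ≤ M * (b - a) ^ 2 := by
  obtain ⟨η, θ, h0, h1, h2⟩ := exists_taylor_remainder hF a b
  rw [h2, abs_mul, abs_of_nonneg h0]
  exact mul_le_mul (h η) h1 h0 hM

lemma abs_sub_le_of_abs_deriv_le {F : ℝ → ℝ} (hF : AnalyticOnNhd ℝ F univ) {M : ℝ}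
    (h : ∀ s, |deriv F s| ≤ M) (a b : ℝ) : |F b - F a| ≤ M * |b - a| := by
  obtain ⟨ξ, -, h1⟩ := exists_mem_uIcc_sub_eq_deriv_mul (differentiable_of_analyticOnNhd hF) a b
  rw [h1, abs_mul]
  gcongr
  exact h ξ

lemma abs_le_add_of_mem_uIcc {a b ξ : ℝ} (h : ξ ∈ uIcc a b) : |ξ| ≤ max |a| |b| := by
  rcases le_total a b with h' | h'
  · rw [uIcc_of_le h'] at h
    exact abs_le_max_abs_abs h.1 h.2
  · rw [uIcc_of_ge h'] at h
    rw [max_comm]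
    exact abs_le_max_abs_abs h.1 h.2

/-- Polynomial growth of the third derivative gives a Lipschitz estimate with polynomial weights
for the first derivative. -/
lemma exists_deriv_sub_le {F : ℝ → ℝ} (hF : AnalyticOnNhd ℝ F univ) {c q : ℝ} (hc : 0 ≤ c)
    (hq : 0 ≤ q) (h : ∀ s, |iteratedDeriv 3 F s| ≤ c * (1 + |s| ^ q)) :
    ∃ (C : ℝ) (m : ℕ), 0 ≤ C ∧ ∀ a b, |deriv F b - deriv F a| ≤
      |b - a| * (C * (1 + |a| ^ (m + 1) + |b| ^ (m + 1))) := by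
  have hd1 := hF.deriv
  have hd2 := hd1.deriv
  -- A natural exponent replaces q, to match the power estimates on Γ, which are obtained by
  -- induction on the exponent.
  obtain ⟨m, hm⟩ := exists_nat_ge q
  have hrpow : ∀ s : ℝ, 0 ≤ s → s ^ q ≤ 1 + s ^ m := by
    intro s hs
    rcases le_total s 1 with h1 | h1
    · have := Real.rpow_le_one hs h1 hq
      have := pow_nonneg hs m
      linarith
    · have := Real.rpow_le_rpow_of_exponent_le h1 hm
      rw [Real.rpow_natCast] at this
      linarith
  have hlow : ∀ s : ℝ, 0 ≤ s → s ≤ 1 + s ^ (m + 1) := by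
    intro s hs
    rcases le_total s 1 with h1 | h1
    · have := pow_nonneg hs (m + 1)
      linarith
    · have := le_self_pow₀ h1 (show m + 1 ≠ 0 by omega)
      linarith
  set B := |deriv (deriv F) 0|
  -- Integrating the third derivative from 0 raises the degree by one.
  have hsecond : ∀ s, |deriv (deriv F) s| ≤ (B + 3 * c) * (1 + |s| ^ (m + 1)) := by
    intro s
    obtain ⟨ξ, hξ, h1⟩ := exists_mem_uIcc_sub_eq_deriv_mul
      (differentiable_of_analyticOnNhd hd2) 0 s
    have h2 : |ξ| ≤ |s| := by simpa using abs_sub_le_of_mem_uIcc hξ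
    have h3 := h ξ
    rw [iteratedDeriv_three_eq] at h3
    have h4 : |ξ| ^ q ≤ 1 + |s| ^ m :=
      (Real.rpow_le_rpow (abs_nonneg _) h2 hq).trans (hrpow _ (abs_nonneg _))
    have h5 : |deriv (deriv F) s - deriv (deriv F) 0| ≤ c * (2 + |s| ^ m) * |s| := by
      rw [h1, abs_mul, sub_zero]
      gcongr
      exact h3.trans (mul_le_mul_of_nonneg_left (by linarith) hc)
    have h6 : |deriv (deriv F) s| ≤ B + c * (2 + |s| ^ m) * |s| := by
      have := abs_sub_abs_le_abs_sub (deriv (deriv F) s) (deriv (deriv F) 0)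
      linarith
    have h7 : (2 + |s| ^ m) * |s| ≤ 3 * (1 + |s| ^ (m + 1)) := by
      have := hlow |s| (abs_nonneg _)
      have h8 : |s| ^ m * |s| = |s| ^ (m + 1) := (pow_succ _ _).symm
      nlinarith [pow_nonneg (abs_nonneg s) (m + 1)]
    have h9 : 0 ≤ B * |s| ^ (m + 1) := by positivity
    nlinarith
  refine ⟨B + 3 * c, m, by positivity, fun a b => ?_⟩
  obtain ⟨ξ, hξ, h1⟩ := exists_mem_uIcc_sub_eq_deriv_mul
    (differentiable_of_analyticOnNhd hd1) a b
  rw [h1, abs_mul, mul_comm]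
  gcongr
  refine (hsecond ξ).trans ?_
  have h2 : |ξ| ^ (m + 1) ≤ |a| ^ (m + 1) + |b| ^ (m + 1) := by
    refine (pow_le_pow_left₀ (abs_nonneg _) (abs_le_add_of_mem_uIcc hξ) _).trans ?_
    rcases max_choice |a| |b| with h | h <;> rw [h]
    · exact le_add_of_nonneg_right (by positivity)
    · exact le_add_of_nonneg_left (by positivity)
  exact mul_le_mul_of_nonneg_left (by linarith) (by positivity)

/-- A function that is bounded below outside a compact interval is bounded below. -/
lemma exists_lower_bound {F : ℝ → ℝ} (hF : Continuous F) {c₁ c₂ c₃ : ℝ} (h1 : 0 < c₁)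
    (h2 : 0 < c₂) (h : ∀ s, c₃ < |s| → c₁ * |s| - c₂ ≤ F s) : ∃ m : ℝ, 0 ≤ m ∧ ∀ s, -m ≤ F s := by
  obtain ⟨C, hC⟩ := (isCompact_Icc (a := -c₃) (b := c₃)).exists_bound_of_continuousOn
    hF.continuousOn
  refine ⟨c₂ + |C|, by positivity, fun s => ?_⟩
  by_cases hs : c₃ < |s|
  · have := h s hs
    have : 0 ≤ c₁ * |s| := by positivity
    have := abs_nonneg C
    linarith
  · have := hC s (abs_le.1 (not_lt.1 hs))
    rw [Real.norm_eq_abs] at this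
    have h3 := neg_abs_le (F s)
    have h4 := le_abs_self C
    linarith

end Scalar

/-! ### Inner products and potentials in L². -/

section LTwo

open scoped RealInnerProductSpace ENNReal

variable {α : Type*} [MeasurableSpace α] {μ : Measure α}

lemma inner_eq_integral (f g : Lp ℝ 2 μ) : ⟪f, g⟫ = ∫ x, f x * g x ∂μ := by
  rw [L2.inner_def]
  refine integral_congr_ae (.of_forall fun x => ?_)
  simp [mul_comm]

lemma integrable_mul_Lp (f g : Lp ℝ 2 μ) : Integrable (fun x => f x * g x) μ :=
  (Lp.memLp f).integrable_mul (Lp.memLp g)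

lemma inner_toLp_right {g : α → ℝ} (f : Lp ℝ 2 μ) (hg : MemLp g 2 μ) :
    ⟪f, hg.toLp g⟫ = ∫ x, f x * g x ∂μ := by
  rw [inner_eq_integral]
  refine integral_congr_ae ?_
  filter_upwards [hg.coeFn_toLp] with x hx
  rw [hx]

lemma tendsto_toLp {f : ℕ → α → ℝ} (hf : ∀ n, MemLp (f n) 2 μ) (g : Lp ℝ 2 μ)
    (h : Tendsto (fun n => eLpNorm (fun x => f n x - g x) 2 μ) atTop (𝓝 0)) :
    Tendsto (fun n => (hf n).toLp (f n)) atTop (𝓝 g) := by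
  have := (Lp.tendsto_Lp_iff_tendsto_eLpNorm'' f hf g (Lp.memLp g)).2 h
  rwa [Lp.toLp_coeFn] at this

/-- Integrability of a semiconvex potential whose derivative is square integrable. -/
lemma integrable_potential [IsFiniteMeasure μ] {F : ℝ → ℝ} (hF : AnalyticOnNhd ℝ F univ) {c m : ℝ}
    (hc : 0 ≤ c) (h2 : ∀ s, -c ≤ iteratedDeriv 2 F s) (hm : ∀ s, -m ≤ F s) (a f : Lp ℝ 2 μ)
    (hf : ∀ᵐ x ∂μ, f x = deriv F (a x)) : Integrable (fun x => F (a x)) μ := by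
  have hFc : Continuous F := (differentiable_of_analyticOnNhd hF).continuous
  have hi : Integrable (fun x => |m| + |F 0| + |f x * a x| + c * (a x * a x)) μ :=
    ((integrable_const _).add (integrable_mul_Lp f a).abs).add
      ((integrable_mul_Lp a a).const_mul c)
  refine hi.mono' (hFc.comp_aestronglyMeasurable (Lp.aestronglyMeasurable a)) ?_
  filter_upwards [hf] with x hx
  -- Semiconvexity at a(x), evaluated at 0, bounds F(a(x)) above by F(0) + f(x)a(x) + c·a(x)², which
  -- is integrable.
  have h3 := semiconvex_le hF hc h2 (a x) 0
  rw [← hx] at h3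
  have h4 := hm (a x)
  rw [Real.norm_eq_abs, abs_le]
  have h5 : 0 ≤ c * (a x * a x) := mul_nonneg hc (mul_self_nonneg _)
  constructor
  · linarith [le_abs_self m, abs_nonneg (F 0), abs_nonneg (f x * a x)]
  · nlinarith [abs_nonneg m, le_abs_self (F 0), le_abs_self (f x * a x)]

lemma integral_potential_ge [IsFiniteMeasure μ] {F : ℝ → ℝ} (hF : AnalyticOnNhd ℝ F univ) {c : ℝ}
    (hc : 0 ≤ c) (h2 : ∀ s, -c ≤ iteratedDeriv 2 F s) (a b f : Lp ℝ 2 μ)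
    (hf : ∀ᵐ x ∂μ, f x = deriv F (a x)) (ha : Integrable (fun x => F (a x)) μ)
    (hb : Integrable (fun x => F (b x)) μ) :
    ∫ x, F (a x) ∂μ + ⟪f, b - a⟫ - c * ‖b - a‖ ^ 2 ≤ ∫ x, F (b x) ∂μ := by
  have h1 : Integrable (fun x => F (a x) + f x * (b - a : Lp ℝ 2 μ) x) μ :=
    ha.add (integrable_mul_Lp _ _)
  have h3 : Integrable (fun x => c * ((b - a : Lp ℝ 2 μ) x * (b - a : Lp ℝ 2 μ) x)) μ :=
    (integrable_mul_Lp _ _).const_mul c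
  rw [← real_inner_self_eq_norm_sq, inner_eq_integral, inner_eq_integral, ← integral_const_mul,
    ← integral_add ha (integrable_mul_Lp _ _), ← integral_sub h1 h3]
  refine integral_mono_ae (h1.sub h3) hb ?_
  filter_upwards [hf, Lp.coeFn_sub b a] with x h3 h4
  rw [h4, h3, Pi.sub_apply, ← sq]
  exact semiconvex_le hF hc h2 (a x) (b x)

end LTwo

/-! ### Green's formulas and H¹(Γ) embeddings. -/

section SobolevBoundary

open scoped RealInnerProductSpace ENNReal NNReal

variable {Ω : Set E3}

lemma continuous_partialDeriv {ψ : E3 → ℝ} (hψ : ContDiff ℝ ∞ ψ) (i : Fin 3) :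
    Continuous (partialDeriv i ψ) :=
  (hψ.continuous_fderiv (by simp)).clm_apply continuous_const

lemma IsSmoothBoundedDomain.memLp_bulk (hΩ : IsSmoothBoundedDomain Ω) {v : E3 → ℝ}
    (hv : Continuous v) : MemLp v 2 (bulkMeasure Ω) := by
  have := hΩ.isFiniteMeasure_bulk
  obtain ⟨C, hC⟩ := hΩ.isBounded.isCompact_closure.exists_bound_of_continuousOn hv.continuousOn
  refine MemLp.of_bound hv.aestronglyMeasurable C ?_
  exact (ae_restrict_iff' hΩ.isOpen.measurableSet).2 (.of_forall fun x hx => hC x (subset_closure hx))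

lemma IsSmoothBoundedDomain.memLp_surf (hΩ : IsSmoothBoundedDomain Ω) {v : E3 → ℝ}
    (hv : Continuous v) : MemLp v 2 (surfaceMeasure Ω) :=
  hΩ.memLp_of_continuousOn hv.continuousOn 2

lemma IsSmoothBoundedDomain.memLp_surfaceGradient (hΩ : IsSmoothBoundedDomain Ω) {ψ : E3 → ℝ}
    (hψ : ContDiff ℝ ∞ ψ) (i : Fin 3) :
    MemLp (fun x => surfaceGradient (frontier Ω) ψ x i) 2 (surfaceMeasure Ω) :=
  hΩ.memLp_of_continuousOn ((EuclideanSpace.proj (𝕜 := ℝ) i).continuous.comp_continuousOn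
    (hΩ.continuousOn_surfaceGradient hψ)) 2

/-- Green's formula for a normal derivative, tested with a function that has a trace. -/
lemma IsNormalDeriv.inner_trace (hΩ : IsSmoothBoundedDomain Ω) {u v : H2Bulk Ω} {d γ : L2Surf Ω}
    (hd : IsNormalDeriv u d) (hγ : IsTrace v γ) :
    ⟪d, γ⟫ = ⟪u.laplacian, v.val⟫ + ∑ i, ⟪u.grad i, v.grad i⟫ := by
  obtain ⟨ψ, hψ, h1, h2, h3⟩ := hγ
  have m1 := fun n => hΩ.memLp_bulk (hψ n).continuous
  have m2 := fun i n => hΩ.memLp_bulk (continuous_partialDeriv (hψ n) i)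
  have m3 := fun n => hΩ.memLp_surf (hψ n).continuous
  have t1 := tendsto_toLp m1 v.val h1
  have t2 := fun i => tendsto_toLp (m2 i) (v.grad i) (h2 i)
  have t3 := tendsto_toLp m3 γ h3
  have hgreen : ∀ n, ⟪d, (m3 n).toLp⟫ =
      ⟪u.laplacian, (m1 n).toLp⟫ + ∑ i, ⟪u.grad i, (m2 i n).toLp⟫ := by
    intro n
    simp only [inner_toLp_right]
    rw [hd (ψ n) (hψ n), integral_add, integral_finsetSum]
    · exact fun i _ => (Lp.memLp (u.grad i)).integrable_mul (m2 i n)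
    · exact (Lp.memLp u.laplacian).integrable_mul (m1 n)
    · exact integrable_finsetSum _ fun i _ => (Lp.memLp (u.grad i)).integrable_mul (m2 i n)
  refine tendsto_nhds_unique (tendsto_const_nhds.inner t3) ?_
  simp only [hgreen]
  exact (tendsto_const_nhds.inner t1).add
    (tendsto_finsetSum _ fun i _ => tendsto_const_nhds.inner (t2 i))

/-- Green's formula on the boundary surface, tested with a function in `H¹(Γ)`. -/
lemma IsLaplaceBeltrami.inner_eq (hΩ : IsSmoothBoundedDomain Ω) {φ : H2Surf Ω} {L ζ : L2Surf Ω}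
    {G : Fin 3 → L2Surf Ω} (hL : IsLaplaceBeltrami φ L) (hζ : HasSurfaceGradient Ω ζ G) :
    ⟪L, ζ⟫ = -∑ i, ⟪φ.grad i, G i⟫ := by
  obtain ⟨ψ, hψ, h1, h2⟩ := hζ
  have m1 := fun n => hΩ.memLp_surf (hψ n).continuous
  have m2 := fun i n => hΩ.memLp_surfaceGradient (hψ n) i
  have t1 := tendsto_toLp m1 ζ h1
  have t2 := fun i => tendsto_toLp (m2 i) (G i) (h2 i)
  have hgreen : ∀ n, ⟪L, (m1 n).toLp⟫ = -∑ i, ⟪φ.grad i, (m2 i n).toLp⟫ := by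
    intro n
    simp only [inner_toLp_right]
    rw [hL (ψ n) (hψ n), integral_finsetSum]
    exact fun i _ => (Lp.memLp (φ.grad i)).integrable_mul (m2 i n)
  refine tendsto_nhds_unique (tendsto_const_nhds.inner t1) ?_
  simp only [hgreen]
  exact (tendsto_finsetSum _ fun i _ => tendsto_const_nhds.inner (t2 i)).neg

lemma surfaceGradient_sub {Γ : Set E3} {ψ η : E3 → ℝ} (hψ : ContDiff ℝ ∞ ψ)
    (hη : ContDiff ℝ ∞ η) (x : E3) :
    surfaceGradient Γ (fun x => ψ x - η x) x = surfaceGradient Γ ψ x - surfaceGradient Γ η x := by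
  rw [surfaceGradient, surfaceGradient, surfaceGradient, gradient, gradient, gradient,
    fderiv_fun_sub (hψ.differentiable (by simp) x) (hη.differentiable (by simp) x), map_sub,
    map_sub]

lemma surfaceGradient_pow {Γ : Set E3} {ψ : E3 → ℝ} (hψ : ContDiff ℝ ∞ ψ) (k : ℕ) (x : E3) :
    surfaceGradient Γ (fun x => ψ x ^ (k + 1)) x =
      ((k + 1 : ℝ) * ψ x ^ k) • surfaceGradient Γ ψ x := by
  rw [surfaceGradient, surfaceGradient, gradient, gradient,
    fderiv_fun_pow (k + 1) (hψ.differentiable (by simp) x)]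
  simp

lemma HasSurfaceGradient.sub {φ ζ : L2Surf Ω} {G H : Fin 3 → L2Surf Ω}
    (hΩ : IsSmoothBoundedDomain Ω) (hφ : HasSurfaceGradient Ω φ G)
    (hζ : HasSurfaceGradient Ω ζ H) : HasSurfaceGradient Ω (φ - ζ) (fun i => G i - H i) := by
  obtain ⟨ψ, hψ, h1, h2⟩ := hφ
  obtain ⟨η, hη, h3, h4⟩ := hζ
  have key : ∀ (f g : ℕ → E3 → ℝ) (a b : L2Surf Ω), (∀ n, MemLp (f n) 2 (surfaceMeasure Ω)) →
      (∀ n, MemLp (g n) 2 (surfaceMeasure Ω)) →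
      Tendsto (fun n => eLpNorm (fun x => f n x - a x) 2 (surfaceMeasure Ω)) atTop (𝓝 0) →
      Tendsto (fun n => eLpNorm (fun x => g n x - b x) 2 (surfaceMeasure Ω)) atTop (𝓝 0) →
      Tendsto (fun n => eLpNorm (fun x => (f n x - g n x) - (a - b : L2Surf Ω) x) 2
        (surfaceMeasure Ω)) atTop (𝓝 0) := by
    intro f g a b hf hg ha hb
    have hab := ha.add hb
    rw [add_zero] at hab
    refine tendsto_of_tendsto_of_tendsto_of_le_of_le tendsto_const_nhds hab (fun _ => zero_le)
      fun n => ?_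
    have e : (fun x => (f n x - g n x) - (a - b : L2Surf Ω) x) =ᵐ[surfaceMeasure Ω]
        (fun x => f n x - a x) - (fun x => g n x - b x) := by
      filter_upwards [Lp.coeFn_sub a b] with x hx
      rw [hx, Pi.sub_apply, Pi.sub_apply]
      ring
    rw [eLpNorm_congr_ae e]
    exact eLpNorm_sub_le ((hf n).1.sub (Lp.aestronglyMeasurable a))
      ((hg n).1.sub (Lp.aestronglyMeasurable b)) (by norm_num)
  refine ⟨fun n x => ψ n x - η n x, fun n => (hψ n).sub (hη n),
    key ψ η φ ζ (fun n => hΩ.memLp_surf (hψ n).continuous)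
      (fun n => hΩ.memLp_surf (hη n).continuous) h1 h3, fun i => ?_⟩
  simp only [surfaceGradient_sub (hψ _) (hη _), PiLp.sub_apply]
  exact key _ _ _ _ (fun n => hΩ.memLp_surfaceGradient (hψ n) i)
    (fun n => hΩ.memLp_surfaceGradient (hη n) i) (h2 i) (h4 i)

/-- Powers of a smooth function on the boundary are controlled by its `H¹(Γ)` norm. -/
lemma IsSmoothBoundedDomain.exists_eLpNorm_pow_le_smooth (hΩ : IsSmoothBoundedDomain Ω) (k : ℕ) :
    ∃ C : ℝ≥0, ∀ ψ : E3 → ℝ, ContDiff ℝ ∞ ψ →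
      eLpNorm (fun x => ψ x ^ (k + 1)) 2 (surfaceMeasure Ω) ≤
        C * (eLpNorm ψ 2 (surfaceMeasure Ω) * (eLpNorm ψ 2 (surfaceMeasure Ω) +
          eLpNorm (surfaceGradient (frontier Ω) ψ) 2 (surfaceMeasure Ω)) ^ k) := by
  obtain ⟨C, hC⟩ := hΩ.gagliardoNirenberg
  -- Inductive step: apply W^{1,1} ⊂ L² to the next power. Its gradient is a multiple of ψ^{k+1}∇_Γ
  -- ψ, so Hölder's inequality leaves the L² norm of the previous power times the H¹ norm of ψ.
  induction k with
  | zero => exact ⟨1, fun ψ hψ => by simp⟩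
  | succ k ih =>
    obtain ⟨D, hD⟩ := ih
    refine ⟨C * (k + 2) * D, fun ψ hψ => ?_⟩
    set σ := surfaceMeasure Ω
    set S := surfaceGradient (frontier Ω) ψ
    have hψm : AEStronglyMeasurable ψ σ := hψ.continuous.aestronglyMeasurable
    have hpm : AEStronglyMeasurable (fun x => ψ x ^ (k + 1)) σ :=
      (hψ.continuous.pow _).aestronglyMeasurable
    have hSm : AEStronglyMeasurable S σ :=
      aestronglyMeasurable_of_continuousOn_frontier (hΩ.continuousOn_surfaceGradient hψ)
    have h1 : eLpNorm (fun x => ψ x ^ (k + 1 + 1)) 1 σ ≤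
        eLpNorm (fun x => ψ x ^ (k + 1)) 2 σ * eLpNorm ψ 2 σ := by
      have : (fun x => ψ x ^ (k + 1 + 1)) = (fun x => ψ x ^ (k + 1)) • ψ := by
        funext x; simp [pow_succ]
      rw [this]
      exact eLpNorm_smul_le_mul_eLpNorm hψm hpm
    have h2 : eLpNorm (surfaceGradient (frontier Ω) fun x => ψ x ^ (k + 1 + 1)) 1 σ ≤
        (k + 2) * (eLpNorm (fun x => ψ x ^ (k + 1)) 2 σ * eLpNorm S 2 σ) := by
      have : (surfaceGradient (frontier Ω) fun x => ψ x ^ (k + 1 + 1)) =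
          (k + 2 : ℝ) • ((fun x => ψ x ^ (k + 1)) • S) := by
        funext x
        rw [surfaceGradient_pow hψ]
        simp only [Pi.smul_apply, Pi.smul_apply', smul_smul, S]
        push_cast
        congr 2
        ring
      rw [this, eLpNorm_const_smul]
      have e : ‖(k + 2 : ℝ)‖ₑ = k + 2 := by
        rw [Real.enorm_eq_ofReal (by positivity), ENNReal.ofReal_add (by positivity) (by norm_num)]
        simp
      rw [e]
      gcongr
      exact eLpNorm_smul_le_mul_eLpNorm hSm hpm
    refine (hC _ (hψ.pow (k + 1 + 1))).trans ?_
    have h3 := hD ψ hψ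
    set N := eLpNorm ψ 2 σ
    set T := eLpNorm S 2 σ
    set Q := eLpNorm (fun x => ψ x ^ (k + 1)) 2 σ
    have hone : (1 : ℝ≥0∞) ≤ k + 2 := by
      have : (1 : ℝ≥0∞) ≤ 2 := by norm_num
      exact this.trans (le_add_of_nonneg_left zero_le)
    calc _ ≤ (C : ℝ≥0∞) * (Q * N + (k + 2) * (Q * T)) := by gcongr
      _ ≤ C * ((k + 2) * (Q * N) + (k + 2) * (Q * T)) := by
          exact mul_le_mul' le_rfl (add_le_add (le_mul_of_one_le_left zero_le hone) le_rfl)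
      _ = C * (k + 2) * (Q * (N + T)) := by ring
      _ ≤ C * (k + 2) * ((D * (N * (N + T) ^ k)) * (N + T)) := by gcongr
      _ = _ := by push_cast; ring

lemma eLpNorm_surfaceGradient_le (hΩ : IsSmoothBoundedDomain Ω) {ψ : E3 → ℝ}
    (hψ : ContDiff ℝ ∞ ψ) : eLpNorm (surfaceGradient (frontier Ω) ψ) 2 (surfaceMeasure Ω) ≤
      ∑ i, eLpNorm (fun x => surfaceGradient (frontier Ω) ψ x i) 2 (surfaceMeasure Ω) := by
  have h1 : eLpNorm (surfaceGradient (frontier Ω) ψ) 2 (surfaceMeasure Ω) ≤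
      eLpNorm (∑ i, fun x => ‖surfaceGradient (frontier Ω) ψ x i‖) 2 (surfaceMeasure Ω) := by
    refine eLpNorm_mono_real fun x => ?_
    rw [Finset.sum_apply, EuclideanSpace.norm_eq]
    refine Real.sqrt_le_iff.2 ⟨by positivity, ?_⟩
    exact Finset.sum_sq_le_sq_sum_of_nonneg fun i _ => norm_nonneg _
  refine h1.trans ((eLpNorm_sum_le (fun i _ =>
    (hΩ.memLp_surfaceGradient hψ i).1.norm) (by norm_num)).trans ?_)
  simp only [eLpNorm_norm, le_refl]

/-- Powers of a function in `H¹(Γ)` are square integrable. -/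
lemma IsSmoothBoundedDomain.exists_eLpNorm_pow_le (hΩ : IsSmoothBoundedDomain Ω) (k : ℕ) :
    ∃ C : ℝ, 0 ≤ C ∧ ∀ (φ : L2Surf Ω) (G : Fin 3 → L2Surf Ω), HasSurfaceGradient Ω φ G →
      eLpNorm (fun x => φ x ^ (k + 1)) 2 (surfaceMeasure Ω) ≤
        ENNReal.ofReal (C * (‖φ‖ * (‖φ‖ + ∑ i, ‖G i‖) ^ k)) := by
  obtain ⟨C, hC⟩ := hΩ.exists_eLpNorm_pow_le_smooth k
  refine ⟨C, C.coe_nonneg, fun φ G hφ => ?_⟩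
  obtain ⟨ψ, hψ, h1, h2⟩ := hφ
  have m1 := fun n => hΩ.memLp_surf (hψ n).continuous
  have m2 := fun i n => hΩ.memLp_surfaceGradient (hψ n) i
  have t1 := tendsto_toLp m1 φ h1
  have t2 := fun i => tendsto_toLp (m2 i) (G i) (h2 i)
  -- An a.e. convergent subsequence lets Fatou's lemma pass the smooth estimate to the limit,
  -- although powers need not converge in L² a priori.
  obtain ⟨ns, hns, hae⟩ := (tendstoInMeasure_of_tendsto_eLpNorm (by norm_num)
    (fun n => (m1 n).1) (Lp.aestronglyMeasurable φ) h1).exists_seq_tendsto_ae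
  have hbound : ∀ n, eLpNorm (fun x => ψ n x ^ (k + 1)) 2 (surfaceMeasure Ω) ≤
      ENNReal.ofReal (C * (‖(m1 n).toLp‖ * (‖(m1 n).toLp‖ + ∑ i, ‖(m2 i n).toLp‖) ^ k)) := by
    intro n
    have e1 : eLpNorm (ψ n) 2 (surfaceMeasure Ω) = ENNReal.ofReal ‖(m1 n).toLp‖ := by
      rw [Lp.norm_toLp, ENNReal.ofReal_toReal (m1 n).eLpNorm_ne_top]
    have e2 : ∀ i, eLpNorm (fun x => surfaceGradient (frontier Ω) (ψ n) x i) 2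
        (surfaceMeasure Ω) = ENNReal.ofReal ‖(m2 i n).toLp‖ := by
      intro i
      rw [Lp.norm_toLp, ENNReal.ofReal_toReal (m2 i n).eLpNorm_ne_top]
    rw [ENNReal.ofReal_mul C.coe_nonneg, ENNReal.ofReal_mul (norm_nonneg _),
      ENNReal.ofReal_pow (by positivity), ENNReal.ofReal_add (norm_nonneg _) (by positivity),
      ENNReal.ofReal_sum_of_nonneg fun i _ => norm_nonneg _, ← e1]
    simp only [← e2]
    refine (hC (ψ n) (hψ n)).trans ?_
    rw [ENNReal.ofReal_coe_nnreal]
    gcongr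
    exact eLpNorm_surfaceGradient_le hΩ (hψ n)
  have hlim : Tendsto (fun n => ENNReal.ofReal (C * (‖(m1 n).toLp‖ *
      (‖(m1 n).toLp‖ + ∑ i, ‖(m2 i n).toLp‖) ^ k))) atTop
      (𝓝 (ENNReal.ofReal (C * (‖φ‖ * (‖φ‖ + ∑ i, ‖G i‖) ^ k)))) := by
    refine ENNReal.tendsto_ofReal (Tendsto.const_mul _ (t1.norm.mul ((t1.norm.add ?_).pow k)))
    exact tendsto_finsetSum _ fun i _ => (t2 i).norm
  have hfatou : eLpNorm (fun x => φ x ^ (k + 1)) 2 (surfaceMeasure Ω) ≤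
      liminf (fun n => eLpNorm (fun x => ψ (ns n) x ^ (k + 1)) 2 (surfaceMeasure Ω)) atTop := by
    refine Lp.eLpNorm_lim_le_liminf_eLpNorm
      (fun n => ((hψ (ns n)).continuous.pow _).aestronglyMeasurable) _ ?_
    filter_upwards [hae] with x hx using hx.pow _
  refine hfatou.trans ((liminf_le_liminf (.of_forall fun n => hbound (ns n))).trans ?_)
  exact (hlim.comp hns.tendsto_atTop).liminf_eq.le

end SobolevBoundary

/-! ### Energy and velocity estimates at fixed times. -/

section StaticEstimates

open scoped RealInnerProductSpace ENNReal NNReal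

variable {Ω : Set E3} {K : ℝ} {F FΓ h : ℝ → ℝ}

/-- A configuration of the system at a positive time: the unknowns `u`, `φ`, the velocities `w`, `v`,
the normal derivative `d` and the trace `γ` of `u`, and the Laplace--Beltrami operator `L` of `φ`. -/
structure IsConfiguration (K : ℝ) (F FΓ h : ℝ → ℝ) (u : H2Bulk Ω) (φ : H2Surf Ω) (w : L2Bulk Ω)
    (v d γ L : L2Surf Ω) : Prop where
  normalDeriv : IsNormalDeriv u d
  trace : IsTrace u γ
  robin : ∀ᵐ x ∂(surfaceMeasure Ω), K * d x + γ x = h (φ.val x)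
  laplaceBeltrami : IsLaplaceBeltrami φ L
  bulk : ∀ᵐ x ∂(bulkMeasure Ω), w x - u.laplacian x + deriv F (u.val x) = 0
  surf : ∀ᵐ x ∂(surfaceMeasure Ω),
    v x - L x + deriv FΓ (φ.val x) + deriv h (φ.val x) * d x = 0

/-- The energy of a configuration. -/
def energy (K : ℝ) (F FΓ : ℝ → ℝ) (u : H2Bulk Ω) (φ : H2Surf Ω) (d : L2Surf Ω) : ℝ :=
  (∑ i, ‖u.grad i‖ ^ 2) / 2 + ∫ x, F (u.val x) ∂(bulkMeasure Ω) +
    (∑ i, ‖φ.grad i‖ ^ 2) / 2 + ∫ x, FΓ (φ.val x) ∂(surfaceMeasure Ω) + K / 2 * ‖d‖ ^ 2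

lemma exists_mul_bounded {g : ℝ → ℝ} (hg : Continuous g) {M : ℝ} (hM : ∀ s, |g s| ≤ M)
    (φ d : L2Surf Ω) : ∃ e : L2Surf Ω, ∀ᵐ x ∂(surfaceMeasure Ω), e x = g (φ x) * d x := by
  have hm : MemLp (fun x => g (φ x) * d x) 2 (surfaceMeasure Ω) := by
    refine MemLp.of_le_mul (c := M) (Lp.memLp d)
      ((hg.comp_aestronglyMeasurable (Lp.aestronglyMeasurable φ)).mul
        (Lp.aestronglyMeasurable d)) (.of_forall fun x => ?_)
    rw [norm_mul]
    exact mul_le_mul_of_nonneg_right (hM _) (norm_nonneg _)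
  exact ⟨hm.toLp, hm.coeFn_toLp⟩

lemma IsConfiguration.robin_sub {u₁ u₂ : H2Bulk Ω} {φ₁ φ₂ : H2Surf Ω} {w₁ w₂ : L2Bulk Ω}
    {v₁ v₂ d₁ d₂ γ₁ γ₂ L₁ L₂ : L2Surf Ω} (h₁ : IsConfiguration K F FΓ h u₁ φ₁ w₁ v₁ d₁ γ₁ L₁)
    (h₂ : IsConfiguration K F FΓ h u₂ φ₂ w₂ v₂ d₂ γ₂ L₂) :
    ∀ᵐ x ∂(surfaceMeasure Ω), (K • (d₂ - d₁) + (γ₂ - γ₁) : L2Surf Ω) x =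
      h (φ₂.val x) - h (φ₁.val x) := by
  filter_upwards [h₁.robin, h₂.robin, Lp.coeFn_add (K • (d₂ - d₁)) (γ₂ - γ₁),
    Lp.coeFn_smul K (d₂ - d₁), Lp.coeFn_sub d₂ d₁, Lp.coeFn_sub γ₂ γ₁] with x r1 r2 e1 e2 e3 e4
  rw [e1, Pi.add_apply, e2, Pi.smul_apply, e3, e4, Pi.sub_apply, Pi.sub_apply, smul_eq_mul,
    ← r1, ← r2]
  ring

/-- The normal derivative depends continuously on the configuration. -/
lemma IsConfiguration.norm_normalDeriv_sub_le (hΩ : IsSmoothBoundedDomain Ω)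
    (hh : AnalyticOnNhd ℝ h univ) {M : ℝ} (hM : ∀ s, |deriv h s| ≤ M) {u₁ u₂ : H2Bulk Ω}
    {φ₁ φ₂ : H2Surf Ω} {w₁ w₂ : L2Bulk Ω} {v₁ v₂ d₁ d₂ γ₁ γ₂ L₁ L₂ : L2Surf Ω}
    (h₁ : IsConfiguration K F FΓ h u₁ φ₁ w₁ v₁ d₁ γ₁ L₁)
    (h₂ : IsConfiguration K F FΓ h u₂ φ₂ w₂ v₂ d₂ γ₂ L₂) :
    K * ‖d₂ - d₁‖ ^ 2 ≤ M * ‖φ₂.val - φ₁.val‖ * ‖d₂ - d₁‖ +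
      ‖u₂.laplacian - u₁.laplacian‖ * ‖u₂.val - u₁.val‖ := by
  have g11 := h₁.normalDeriv.inner_trace hΩ h₁.trace
  have g12 := h₁.normalDeriv.inner_trace hΩ h₂.trace
  have g21 := h₂.normalDeriv.inner_trace hΩ h₁.trace
  have g22 := h₂.normalDeriv.inner_trace hΩ h₂.trace
  -- Green's formula for the difference: the gradient term is nonnegative, so pairing the Robin
  -- condition with d₂ − d₁ controls K‖d₂ − d₁‖² without any trace estimate.
  have e1 : ⟪d₂ - d₁, γ₂ - γ₁⟫ = ⟪u₂.laplacian - u₁.laplacian, u₂.val - u₁.val⟫ +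
      ∑ i, ⟪u₂.grad i - u₁.grad i, u₂.grad i - u₁.grad i⟫ := by
    simp only [inner_sub_left, inner_sub_right, Finset.sum_sub_distrib]
    rw [g11, g12, g21, g22]
    ring
  have e2 : 0 ≤ ∑ i, ⟪u₂.grad i - u₁.grad i, u₂.grad i - u₁.grad i⟫ :=
    Finset.sum_nonneg fun i _ => real_inner_self_nonneg
  have e3 : ‖K • (d₂ - d₁) + (γ₂ - γ₁)‖ ≤ M * ‖φ₂.val - φ₁.val‖ := by
    refine Lp.norm_le_mul_norm_of_ae_le_mul ?_
    filter_upwards [h₁.robin_sub h₂, Lp.coeFn_sub φ₂.val φ₁.val] with x r1 r2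
    rw [r1, r2]
    exact abs_sub_le_of_abs_deriv_le hh hM _ _
  have e4 : ⟪d₂ - d₁, K • (d₂ - d₁) + (γ₂ - γ₁)⟫ = K * ‖d₂ - d₁‖ ^ 2 + ⟪d₂ - d₁, γ₂ - γ₁⟫ := by
    rw [inner_add_right, inner_smul_right, real_inner_self_eq_norm_sq]
  have e5 := real_inner_le_norm (d₂ - d₁) (K • (d₂ - d₁) + (γ₂ - γ₁))
  have e6 := mul_le_mul_of_nonneg_left e3 (norm_nonneg (d₂ - d₁))
  have e7 := neg_le_of_abs_le
    (abs_real_inner_le_norm (u₂.laplacian - u₁.laplacian) (u₂.val - u₁.val))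
  nlinarith

/-- By the Robin condition the integrand is d₁ times the first order Taylor remainder of h, hence at
least −M|d₁|(φ₂ − φ₁)²; Cauchy–Schwarz finishes. -/
lemma IsConfiguration.coupling_ge (hh : AnalyticOnNhd ℝ h univ) {M : ℝ} (hM0 : 0 ≤ M)
    (hM : ∀ s, |iteratedDeriv 2 h s| ≤ M) {u₁ u₂ : H2Bulk Ω}
    {φ₁ φ₂ : H2Surf Ω} {w₁ w₂ : L2Bulk Ω} {v₁ v₂ d₁ d₂ γ₁ γ₂ L₁ L₂ e : L2Surf Ω}
    (h₁ : IsConfiguration K F FΓ h u₁ φ₁ w₁ v₁ d₁ γ₁ L₁)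
    (h₂ : IsConfiguration K F FΓ h u₂ φ₂ w₂ v₂ d₂ γ₂ L₂)
    (he : ∀ᵐ x ∂(surfaceMeasure Ω), e x = deriv h (φ₁.val x) * d₁ x) {R : ℝ} (hR : 0 ≤ R)
    (hz : eLpNorm (fun x => (φ₂.val - φ₁.val : L2Surf Ω) x ^ 2) 2 (surfaceMeasure Ω) ≤
      ENNReal.ofReal R) :
    -(M * (‖d₁‖ * R)) ≤ ⟪d₁, K • (d₂ - d₁) + (γ₂ - γ₁)⟫ - ⟪e, φ₂.val - φ₁.val⟫ := by
  have hzm : MemLp (fun x => (φ₂.val - φ₁.val : L2Surf Ω) x ^ 2) 2 (surfaceMeasure Ω) :=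
    ⟨(Lp.aestronglyMeasurable _).pow 2, hz.trans_lt ENNReal.ofReal_lt_top⟩
  have hzn : ‖hzm.toLp‖ ≤ R := by
    rw [Lp.norm_toLp]
    exact ENNReal.toReal_le_of_le_ofReal hR hz
  have h3 : ⟪|d₁|, hzm.toLp⟫ ≤ ‖d₁‖ * R := by
    refine (real_inner_le_norm _ _).trans ?_
    rw [norm_abs_eq_norm]
    gcongr
  have h4 : -(M * ⟪|d₁|, hzm.toLp⟫) ≤
      ⟪d₁, K • (d₂ - d₁) + (γ₂ - γ₁)⟫ - ⟪e, φ₂.val - φ₁.val⟫ := by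
    rw [inner_eq_integral, inner_eq_integral, inner_eq_integral, ← integral_const_mul,
      ← integral_neg, ← integral_sub (integrable_mul_Lp _ _) (integrable_mul_Lp _ _)]
    refine integral_mono_ae ((integrable_mul_Lp _ _).const_mul M).neg
      ((integrable_mul_Lp _ _).sub (integrable_mul_Lp _ _)) ?_
    filter_upwards [h₁.robin_sub h₂, he, Lp.coeFn_sub φ₂.val φ₁.val, hzm.coeFn_toLp,
      Lp.coeFn_abs d₁] with x r1 r2 r3 r4 r5
    rw [r1, r2, r4, r5, r3, Pi.sub_apply]
    have h5 := abs_taylor_remainder_le hh hM0 hM (φ₁.val x) (φ₂.val x)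
    have h6 : |d₁ x * (h (φ₂.val x) - h (φ₁.val x) -
        deriv h (φ₁.val x) * (φ₂.val x - φ₁.val x))| ≤
        |d₁ x| * (M * (φ₂.val x - φ₁.val x) ^ 2) := by
      rw [abs_mul]
      gcongr
    have := neg_le_of_abs_le h6
    linarith
  nlinarith [mul_le_mul_of_nonneg_left h3 hM0]

/-- Young's inequality with weights making the S² part S²/6 ≤ Q/2. The factor 3 counts the ambient
components of the surface gradient. -/
lemma coupling_absorption {a c S Q : ℝ} (δ N : ℝ) (ha : 0 ≤ a) (hc : 0 ≤ c) (hSQ : S ^ 2 ≤ 3 * Q) (U : ℝ) :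
    a * δ * (N * (N + S)) + c * U ^ 2 + c * N ^ 2 ≤
      Q / 2 + (c + a + 3 * a ^ 2) * (1 + δ ^ 2) * (U ^ 2 + N ^ 2) := by
  have h1 : (a * δ * N) * S ≤ 3 / 2 * (a * δ * N) ^ 2 + S ^ 2 / 6 := by
    nlinarith [sq_nonneg (3 * (a * δ * N) - S)]
  have h2 : a * δ * N ^ 2 ≤ a * (1 + δ ^ 2) * N ^ 2 := by
    gcongr
    nlinarith [sq_nonneg (δ - 1)]
  have h3 : 0 ≤ a ^ 2 * N ^ 2 := by positivity
  have h4 : 0 ≤ a ^ 2 * δ ^ 2 * N ^ 2 := by positivity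
  have h5 : 0 ≤ c * δ ^ 2 * (U ^ 2 + N ^ 2) := by positivity
  have h6 : 0 ≤ (a + 3 * a ^ 2) * (1 + δ ^ 2) * U ^ 2 := by positivity
  nlinarith

/-- Ladyzhenskaya's inequality on the boundary surface. -/
lemma IsSmoothBoundedDomain.exists_eLpNorm_sq_le (hΩ : IsSmoothBoundedDomain Ω) :
    ∃ C : ℝ, 0 ≤ C ∧ ∀ (φ : L2Surf Ω) (G : Fin 3 → L2Surf Ω), HasSurfaceGradient Ω φ G →
      eLpNorm (fun x => φ x ^ 2) 2 (surfaceMeasure Ω) ≤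
        ENNReal.ofReal (C * (‖φ‖ * (‖φ‖ + ∑ i, ‖G i‖))) := by
  obtain ⟨C, hC0, hC⟩ := hΩ.exists_eLpNorm_pow_le 1
  refine ⟨C, hC0, fun φ G hφ => ?_⟩
  have := hC φ G hφ
  simpa only [Nat.reduceAdd, pow_one] using this

/-- The energy is semiconvex along configurations, with a modulus controlled by the normal
derivative. -/
theorem exists_energy_semiconvex (hΩ : IsSmoothBoundedDomain Ω) (hK : 0 < K) {p q : ℝ}
    (hh : CouplingAssumption q h) (hF : PotentialAssumption p q F FΓ) :
    ∃ C : ℝ, 0 ≤ C ∧ ∀ (u₁ u₂ : H2Bulk Ω) (φ₁ φ₂ : H2Surf Ω) (w₁ w₂ : L2Bulk Ω)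
      (v₁ v₂ d₁ d₂ γ₁ γ₂ L₁ L₂ : L2Surf Ω), IsConfiguration K F FΓ h u₁ φ₁ w₁ v₁ d₁ γ₁ L₁ →
      IsConfiguration K F FΓ h u₂ φ₂ w₂ v₂ d₂ γ₂ L₂ →
      energy K F FΓ u₁ φ₁ d₁ - (⟪w₁, u₂.val - u₁.val⟫ + ⟪v₁, φ₂.val - φ₁.val⟫) -
        C * (1 + ‖d₁‖ ^ 2) * (‖u₂.val - u₁.val‖ ^ 2 + ‖φ₂.val - φ₁.val‖ ^ 2) ≤
          energy K F FΓ u₂ φ₂ d₂ := by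
  have := hΩ.isFiniteMeasure_bulk
  have := hΩ.isFiniteMeasure_surface
  obtain ⟨M₁, hM₁⟩ := hh.bounded_deriv
  obtain ⟨M, hM⟩ := hh.bounded_deriv_two
  have hM0 : 0 ≤ M := (abs_nonneg _).trans (hM 0)
  obtain ⟨c₀, c₁, c₂, c₃, c, -, hc₁, hc₂, -, hc, -, -, hlow, hlowΓ, hconv, hconvΓ⟩ := hF.bounds
  obtain ⟨m, -, hm⟩ := exists_lower_bound
    (differentiable_of_analyticOnNhd hF.analytic_bulk).continuous hc₁ hc₂ hlow
  obtain ⟨mΓ, -, hmΓ⟩ := exists_lower_bound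
    (differentiable_of_analyticOnNhd hF.analytic_surf).continuous hc₁ hc₂ hlowΓ
  obtain ⟨D, hD0, hD⟩ := hΩ.exists_eLpNorm_sq_le
  refine ⟨c + M * D + 3 * (M * D) ^ 2, by positivity, ?_⟩
  intro u₁ u₂ φ₁ φ₂ w₁ w₂ v₁ v₂ d₁ d₂ γ₁ γ₂ L₁ L₂ h₁ h₂
  -- F'(u) and F_Γ'(φ) lie in L² because the equations express them through L² functions; this gives
  -- integrability of the potentials and identifies their subgradients.
  have hpot : ∀ {u : H2Bulk Ω} {φ : H2Surf Ω} {w : L2Bulk Ω} {v d γ L : L2Surf Ω},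
      IsConfiguration K F FΓ h u φ w v d γ L →
      (∀ᵐ x ∂(bulkMeasure Ω), (u.laplacian - w : L2Bulk Ω) x = deriv F (u.val x)) ∧
      ∃ e : L2Surf Ω, (∀ᵐ x ∂(surfaceMeasure Ω), e x = deriv h (φ.val x) * d x) ∧
        ∀ᵐ x ∂(surfaceMeasure Ω), (L - v - e : L2Surf Ω) x = deriv FΓ (φ.val x) := by
    intro u φ w v d γ L hc
    refine ⟨?_, ?_⟩
    · filter_upwards [hc.bulk, Lp.coeFn_sub u.laplacian w] with x r1 r2
      rw [r2, Pi.sub_apply]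
      linarith
    · obtain ⟨e, he⟩ := exists_mul_bounded (g := deriv h)
        (differentiable_of_analyticOnNhd hh.analytic.deriv).continuous hM₁ φ.val d
      refine ⟨e, he, ?_⟩
      filter_upwards [hc.surf, he, Lp.coeFn_sub (L - v) e, Lp.coeFn_sub L v] with x r1 r2 r3 r4
      rw [r3, Pi.sub_apply, r4, Pi.sub_apply]
      linarith
  obtain ⟨f₁, e₁, he₁, g₁⟩ := hpot h₁
  obtain ⟨f₂, e₂, he₂, g₂⟩ := hpot h₂
  have hb := integral_potential_ge hF.analytic_bulk hc.le hconv u₁.val u₂.val _ f₁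
    (integrable_potential hF.analytic_bulk hc.le hconv hm u₁.val _ f₁)
    (integrable_potential hF.analytic_bulk hc.le hconv hm u₂.val _ f₂)
  have hs := integral_potential_ge hF.analytic_surf hc.le hconvΓ φ₁.val φ₂.val _ g₁
    (integrable_potential hF.analytic_surf hc.le hconvΓ hmΓ φ₁.val _ g₁)
    (integrable_potential hF.analytic_surf hc.le hconvΓ hmΓ φ₂.val _ g₂)
  have hζ := φ₂.hasSurfaceGradient.sub hΩ φ₁.hasSurfaceGradient
  -- bulk gradient
  have green₁ := h₁.normalDeriv.inner_trace hΩ h₁.trace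
  have green₂ := h₁.normalDeriv.inner_trace hΩ h₂.trace
  -- Convexity of the Dirichlet energy, with Green's formula producing the boundary term that the
  -- Robin condition converts into the coupling.
  have hgrad : ⟪d₁, γ₂ - γ₁⟫ - ⟪u₁.laplacian, u₂.val - u₁.val⟫ ≤
      (∑ i, ‖u₂.grad i‖ ^ 2) / 2 - (∑ i, ‖u₁.grad i‖ ^ 2) / 2 := by
    have e : ⟪d₁, γ₂ - γ₁⟫ - ⟪u₁.laplacian, u₂.val - u₁.val⟫ =
        ∑ i, (⟪u₁.grad i, u₂.grad i⟫ - ‖u₁.grad i‖ ^ 2) := by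
      simp only [inner_sub_right, Finset.sum_sub_distrib]
      rw [green₁, green₂]
      simp only [real_inner_self_eq_norm_sq]
      ring
    rw [e, Finset.sum_div, Finset.sum_div, ← Finset.sum_sub_distrib]
    refine Finset.sum_le_sum fun i _ => ?_
    have := real_inner_le_norm (u₁.grad i) (u₂.grad i)
    nlinarith [sq_nonneg (‖u₁.grad i‖ - ‖u₂.grad i‖)]
  -- surface gradient
  have hsurf : -⟪L₁, φ₂.val - φ₁.val⟫ + (∑ i, ‖φ₂.grad i - φ₁.grad i‖ ^ 2) / 2 =
      (∑ i, ‖φ₂.grad i‖ ^ 2) / 2 - (∑ i, ‖φ₁.grad i‖ ^ 2) / 2 := by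
    rw [h₁.laplaceBeltrami.inner_eq hΩ hζ, neg_neg, Finset.sum_div, Finset.sum_div,
      Finset.sum_div, ← Finset.sum_sub_distrib, ← Finset.sum_add_distrib]
    refine Finset.sum_congr rfl fun i _ => ?_
    rw [norm_sub_sq_real, inner_sub_right, real_inner_self_eq_norm_sq, real_inner_comm]
    ring
  -- coupling
  set N := ‖φ₂.val - φ₁.val‖
  set S := ∑ i, ‖φ₂.grad i - φ₁.grad i‖
  have hN0 : 0 ≤ N := norm_nonneg _
  have hS0 : 0 ≤ S := Finset.sum_nonneg fun i _ => norm_nonneg _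
  have hS2 : S ^ 2 ≤ 3 * ∑ i, ‖φ₂.grad i - φ₁.grad i‖ ^ 2 := by
    have := sq_sum_le_card_mul_sum_sq (s := Finset.univ)
      (f := fun i : Fin 3 => ‖φ₂.grad i - φ₁.grad i‖)
    simpa using this
  have hcoup := h₁.coupling_ge hh.analytic hM0 hM h₂ he₁ (R := D * (N * (N + S)))
    (mul_nonneg hD0 (mul_nonneg hN0 (add_nonneg hN0 hS0))) (hD _ _ hζ)
  have hd : K * ⟪d₁, d₂ - d₁⟫ ≤ K / 2 * ‖d₂‖ ^ 2 - K / 2 * ‖d₁‖ ^ 2 := by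
    have h3 := real_inner_le_norm d₁ d₂
    rw [inner_sub_right, real_inner_self_eq_norm_sq]
    nlinarith [sq_nonneg (‖d₁‖ - ‖d₂‖)]
  have hη : ⟪d₁, K • (d₂ - d₁) + (γ₂ - γ₁)⟫ = K * ⟪d₁, d₂ - d₁⟫ + ⟪d₁, γ₂ - γ₁⟫ := by
    rw [inner_add_right, inner_smul_right]
  rw [hη] at hcoup
  rw [inner_sub_left] at hb
  rw [inner_sub_left, inner_sub_left] at hs
  -- The surplus ½‖∇_Γ(φ₂ − φ₁)‖², kept by stating `hsurf` as an equality, pays for the gradient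
  -- factor of Ladyzhenskaya's inequality.
  have habs := coupling_absorption ‖d₁‖ N (mul_nonneg hM0 hD0) hc.le hS2
    ‖u₂.val - u₁.val‖
  have hMD : M * (‖d₁‖ * (D * (N * (N + S)))) = M * D * ‖d₁‖ * (N * (N + S)) := by ring
  rw [hMD] at hcoup
  simp only [energy]
  linarith

/-- The energy controls the normal derivative and is bounded below. -/
lemma exists_energy_ge (hΩ : IsSmoothBoundedDomain Ω) {p q : ℝ}
    (hF : PotentialAssumption p q F FΓ) :
    ∃ m : ℝ, ∀ (u : H2Bulk Ω) (φ : H2Surf Ω) (d : L2Surf Ω),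
      K / 2 * ‖d‖ ^ 2 - m ≤ energy K F FΓ u φ d := by
  have := hΩ.isFiniteMeasure_bulk
  have := hΩ.isFiniteMeasure_surface
  obtain ⟨c₀, c₁, c₂, c₃, c, -, hc₁, hc₂, -, hc, -, -, hlow, hlowΓ, hconv, hconvΓ⟩ := hF.bounds
  obtain ⟨m, hm0, hm⟩ := exists_lower_bound
    (differentiable_of_analyticOnNhd hF.analytic_bulk).continuous hc₁ hc₂ hlow
  obtain ⟨mΓ, hmΓ0, hmΓ⟩ := exists_lower_bound
    (differentiable_of_analyticOnNhd hF.analytic_surf).continuous hc₁ hc₂ hlowΓ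
  have key : ∀ {μ : Measure E3} [IsFiniteMeasure μ] {g : E3 → ℝ} {b : ℝ}, 0 ≤ b →
      (∀ x, -b ≤ g x) → -(b * μ.real univ) ≤ ∫ x, g x ∂μ := by
    intro μ _ g b hb0 hb
    by_cases hg : Integrable g μ
    · have := integral_mono (integrable_const (-b)) hg hb
      rw [integral_const, smul_eq_mul] at this
      linarith
    -- A nonintegrable potential has integral 0 by convention, which still satisfies the lower
    -- bound.
    · rw [integral_undef hg]
      have : 0 ≤ b * μ.real univ := by positivity
      linarith
  refine ⟨m * (bulkMeasure Ω).real univ + mΓ * (surfaceMeasure Ω).real univ, fun u φ d => ?_⟩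
  have h1 := key (μ := bulkMeasure Ω) hm0 (fun x => hm (u.val x))
  have h2 := key (μ := surfaceMeasure Ω) hmΓ0 (fun x => hmΓ (φ.val x))
  have h3 : 0 ≤ ∑ i, ‖u.grad i‖ ^ 2 := Finset.sum_nonneg fun i _ => sq_nonneg _
  have h4 : 0 ≤ ∑ i, ‖φ.grad i‖ ^ 2 := Finset.sum_nonneg fun i _ => sq_nonneg _
  simp only [energy]
  linarith

lemma velocity_weight_le {A T D M M₁ R₁ R₂ d z y : ℝ} (hA : 0 ≤ A) (hT : 0 ≤ T) (hD : 0 ≤ D)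
    (hM : 0 ≤ M) (hM₁ : 0 ≤ M₁) (hR₁ : 0 ≤ R₁) (hR₂ : 0 ≤ R₂) (hd : 0 ≤ d) (hz : 0 ≤ z)
    (hy : 0 ≤ y) :
    z * (A * (T + D * R₁ + D * R₂) + M * d) + M₁ * (y * T) ≤
      (A * T + A * D + M + M₁ * T) * (z * (1 + R₁ + R₂ + d) + y) := by
  have h1 : A * (T + D * R₁ + D * R₂) + M * d ≤
      (A * T + A * D + M + M₁ * T) * (1 + R₁ + R₂ + d) := by
    have a1 : 0 ≤ A * T * (R₁ + R₂ + d) := by positivity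
    have a2 : 0 ≤ A * D * (1 + d) := by positivity
    have a3 : 0 ≤ M₁ * T * (1 + R₁ + R₂ + d) := by positivity
    have a4 : 0 ≤ M * (1 + R₁ + R₂) := by positivity
    linarith
  have h2 := mul_le_mul_of_nonneg_left h1 hz
  have h3 : 0 ≤ (A * T + A * D + M) * y := by positivity
  linarith

/-- Weak continuity of the surface velocity, up to the Laplace--Beltrami term. -/
lemma exists_surface_velocity_sub_le (hΩ : IsSmoothBoundedDomain Ω) {p q : ℝ} (hq : 0 ≤ q)
    (hh : CouplingAssumption q h) (hF : PotentialAssumption p q F FΓ) :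
    ∃ (C : ℝ) (m : ℕ), 0 ≤ C ∧ ∀ (u₁ u₂ : H2Bulk Ω) (φ₁ φ₂ : H2Surf Ω) (w₁ w₂ : L2Bulk Ω)
      (v₁ v₂ d₁ d₂ γ₁ γ₂ L₁ L₂ : L2Surf Ω), IsConfiguration K F FΓ h u₁ φ₁ w₁ v₁ d₁ γ₁ L₁ →
      IsConfiguration K F FΓ h u₂ φ₂ w₂ v₂ d₂ γ₂ L₂ → ∀ (X : L2Surf Ω) (B : ℝ), 0 ≤ B →
      (∀ᵐ x ∂(surfaceMeasure Ω), |X x| ≤ B) →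
      |⟪(v₂ - v₁) - (L₂ - L₁), X⟫| ≤ B * (C * (‖φ₂.val - φ₁.val‖ *
        (1 + ‖φ₁.val‖ * (‖φ₁.val‖ + ∑ i, ‖φ₁.grad i‖) ^ m +
          ‖φ₂.val‖ * (‖φ₂.val‖ + ∑ i, ‖φ₂.grad i‖) ^ m + ‖d₁‖) + ‖d₂ - d₁‖)) := by
  have := hΩ.isFiniteMeasure_surface
  obtain ⟨M₁, hM₁⟩ := hh.bounded_deriv
  have hM₁0 : 0 ≤ M₁ := (abs_nonneg _).trans (hM₁ 0)
  obtain ⟨M, hM⟩ := hh.bounded_deriv_two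
  have hM0 : 0 ≤ M := (abs_nonneg _).trans (hM 0)
  obtain ⟨c₀, c₁, c₂, c₃, c, hc₀, -, -, -, -, -, hgrow, -⟩ := hF.bounds
  obtain ⟨A, m, hA0, hA⟩ := exists_deriv_sub_le hF.analytic_surf hc₀.le hq hgrow
  obtain ⟨D, hD0, hD⟩ := hΩ.exists_eLpNorm_pow_le m
  have hone : MemLp (fun _ : E3 => (1 : ℝ)) 2 (surfaceMeasure Ω) := memLp_const 1
  set T := ‖hone.toLp‖
  have hT0 : 0 ≤ T := norm_nonneg _
  refine ⟨A * T + A * D + M + M₁ * T, m, by positivity, ?_⟩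
  intro u₁ u₂ φ₁ φ₂ w₁ w₂ v₁ v₂ d₁ d₂ γ₁ γ₂ L₁ L₂ h₁ h₂ X B hB0 hB
  have hnn : ∀ φ : H2Surf Ω, 0 ≤ ‖φ.val‖ * (‖φ.val‖ + ∑ i, ‖φ.grad i‖) ^ m := fun φ =>
    mul_nonneg (norm_nonneg _) (pow_nonneg (add_nonneg (norm_nonneg _)
      (Finset.sum_nonneg fun i _ => norm_nonneg _)) _)
  have hP : ∀ φ : H2Surf Ω, ∃ P : L2Surf Ω, (∀ᵐ x ∂(surfaceMeasure Ω),
      P x = |φ.val x| ^ (m + 1)) ∧ ‖P‖ ≤ D * (‖φ.val‖ * (‖φ.val‖ + ∑ i, ‖φ.grad i‖) ^ m) := by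
    intro φ
    have hb := hD _ _ φ.hasSurfaceGradient
    have hmem : MemLp (fun x => φ.val x ^ (m + 1)) 2 (surfaceMeasure Ω) :=
      ⟨(Lp.aestronglyMeasurable _).pow _, hb.trans_lt ENNReal.ofReal_lt_top⟩
    refine ⟨|hmem.toLp|, ?_, ?_⟩
    · filter_upwards [Lp.coeFn_abs hmem.toLp, hmem.coeFn_toLp] with x r1 r2
      rw [r1, r2, abs_pow]
    · rw [norm_abs_eq_norm, Lp.norm_toLp]
      exact ENNReal.toReal_le_of_le_ofReal (mul_nonneg hD0 (hnn φ)) hb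
  obtain ⟨P₁, hP₁, hP₁n⟩ := hP φ₁
  obtain ⟨P₂, hP₂, hP₂n⟩ := hP φ₂
  set R₁ := ‖φ₁.val‖ * (‖φ₁.val‖ + ∑ i, ‖φ₁.grad i‖) ^ m
  set R₂ := ‖φ₂.val‖ * (‖φ₂.val‖ + ∑ i, ‖φ₂.grad i‖) ^ m
  have hR₁0 : 0 ≤ R₁ := hnn φ₁
  have hR₂0 : 0 ≤ R₂ := hnn φ₂
  set ζ := φ₂.val - φ₁.val with hζ
  set δ := d₂ - d₁ with hδ
  set g := (v₂ - v₁) - (L₂ - L₁) with hg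
  -- Subtraction of the two surface equations, with h'(φ₂)d₂ − h'(φ₁)d₁ split so that only d₁
  -- multiplies the increment of h'. The resulting products are merely L¹, hence the bounded test
  -- function X.
  have hpt : ∀ᵐ x ∂(surfaceMeasure Ω), |g x| ≤
      |ζ x| * (A * (1 + P₁ x + P₂ x) + M * |d₁ x|) + M₁ * |δ x| := by
    filter_upwards [h₁.surf, h₂.surf, hP₁, hP₂, Lp.coeFn_sub φ₂.val φ₁.val, Lp.coeFn_sub d₂ d₁,
      Lp.coeFn_sub (v₂ - v₁) (L₂ - L₁), Lp.coeFn_sub v₂ v₁, Lp.coeFn_sub L₂ L₁]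
      with x s1 s2 r1 r2 r3 r4 r5 r6 r7
    rw [hg, r5, Pi.sub_apply, r6, r7, Pi.sub_apply, Pi.sub_apply, r1, r2, hζ, r3, hδ, r4,
      Pi.sub_apply, Pi.sub_apply]
    have k1 := hA (φ₁.val x) (φ₂.val x)
    have k2 : |deriv h (φ₂.val x) - deriv h (φ₁.val x)| ≤ M * |φ₂.val x - φ₁.val x| := by
      refine abs_sub_le_of_abs_deriv_le hh.analytic.deriv (fun s => ?_) _ _
      rw [← iteratedDeriv_two_eq]
      exact hM s
    have k3 : (v₂ x - v₁ x) - (L₂ x - L₁ x) = -((deriv FΓ (φ₂.val x) - deriv FΓ (φ₁.val x)) +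
        ((deriv h (φ₂.val x) - deriv h (φ₁.val x)) * d₁ x +
          deriv h (φ₂.val x) * (d₂ x - d₁ x))) := by
      linear_combination s2 - s1
    have k4 : |(deriv h (φ₂.val x) - deriv h (φ₁.val x)) * d₁ x| ≤
        M * |φ₂.val x - φ₁.val x| * |d₁ x| := by
      rw [abs_mul]; gcongr
    have k5 : |deriv h (φ₂.val x) * (d₂ x - d₁ x)| ≤ M₁ * |d₂ x - d₁ x| := by
      rw [abs_mul]; gcongr; exact hM₁ _
    rw [k3, abs_neg]
    refine (abs_add_le _ _).trans ?_
    have k6 := abs_add_le ((deriv h (φ₂.val x) - deriv h (φ₁.val x)) * d₁ x)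
      (deriv h (φ₂.val x) * (d₂ x - d₁ x))
    nlinarith
  let W : L2Surf Ω := A • (hone.toLp + P₁ + P₂) + M • |d₁|
  have hW : ∀ᵐ x ∂(surfaceMeasure Ω), W x = A * (1 + P₁ x + P₂ x) + M * |d₁ x| := by
    filter_upwards [Lp.coeFn_add (A • (hone.toLp + P₁ + P₂)) (M • |d₁|),
      Lp.coeFn_smul A (hone.toLp + P₁ + P₂), Lp.coeFn_smul M |d₁|, Lp.coeFn_abs d₁,
      Lp.coeFn_add (hone.toLp + P₁) P₂, Lp.coeFn_add hone.toLp P₁, hone.coeFn_toLp]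
      with x r1 r2 r3 r4 r5 r6 r7
    rw [r1, Pi.add_apply, r2, r3, Pi.smul_apply, Pi.smul_apply, r4, r5, Pi.add_apply, r6,
      Pi.add_apply, r7, smul_eq_mul, smul_eq_mul]
  have hWn : ‖W‖ ≤ A * (T + D * R₁ + D * R₂) + M * ‖d₁‖ := by
    refine (norm_add_le _ _).trans ?_
    rw [norm_smul, norm_smul, norm_abs_eq_norm, Real.norm_of_nonneg hA0, Real.norm_of_nonneg hM0]
    gcongr
    exact (norm_add₃_le).trans (by gcongr)
  have hint : |⟪g, X⟫| ≤ B * (⟪|ζ|, W⟫ + M₁ * ⟪|δ|, hone.toLp⟫) := by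
    have i1 := integrable_mul_Lp |ζ| W
    have i2 := (integrable_mul_Lp |δ| hone.toLp).const_mul M₁
    rw [inner_eq_integral, inner_eq_integral, inner_eq_integral, ← integral_const_mul,
      ← integral_add i1 i2, ← integral_const_mul, ← Real.norm_eq_abs]
    refine norm_integral_le_of_norm_le ((i1.add i2).const_mul B) ?_
    filter_upwards [hpt, hW, hB, Lp.coeFn_abs ζ, Lp.coeFn_abs δ, hone.coeFn_toLp]
      with x r1 r2 r3 r4 r5 r6
    rw [norm_mul, Real.norm_eq_abs, Real.norm_eq_abs, mul_comm]
    rw [← r2] at r1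
    rw [r4, r5, r6, mul_one]
    exact mul_le_mul r3 r1 (abs_nonneg _) hB0
  refine hint.trans ?_
  gcongr
  have j1 : ⟪|ζ|, W⟫ ≤ ‖ζ‖ * (A * (T + D * R₁ + D * R₂) + M * ‖d₁‖) := by
    refine (real_inner_le_norm _ _).trans ?_
    rw [norm_abs_eq_norm]
    gcongr
  have j2 : ⟪|δ|, hone.toLp⟫ ≤ ‖δ‖ * T := by
    refine (real_inner_le_norm _ _).trans ?_
    rw [norm_abs_eq_norm]
  exact (add_le_add j1 (mul_le_mul_of_nonneg_left j2 hM₁0)).trans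
    (velocity_weight_le hA0 hT0 hD0 hM0 hM₁0 hR₁0 hR₂0 (norm_nonneg d₁) (norm_nonneg ζ)
      (norm_nonneg δ))

end StaticEstimates

/-! ### Continuity in time and pointwise bounds on the velocities. -/

section Trajectories

open scoped RealInnerProductSpace ENNReal NNReal

variable {Ω : Set E3} {K : ℝ} {F FΓ h : ℝ → ℝ}

lemma continuous_bulk_components : Continuous fun u : H2Bulk Ω => (u.val, u.grad, u.hess) :=
  continuous_induced_dom

lemma H2Bulk.continuous_val : Continuous (H2Bulk.val : H2Bulk Ω → L2Bulk Ω) :=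
  continuous_bulk_components.fst

lemma H2Bulk.continuous_laplacian : Continuous (H2Bulk.laplacian : H2Bulk Ω → L2Bulk Ω) :=
  continuous_finsetSum _ fun i _ => (continuous_apply i).comp
    ((continuous_apply i).comp continuous_bulk_components.snd.snd)

lemma continuous_surf_components : Continuous fun φ : H2Surf Ω => (φ.val, φ.grad, φ.hess) :=
  continuous_induced_dom

lemma H2Surf.continuous_val : Continuous (H2Surf.val : H2Surf Ω → L2Surf Ω) :=
  continuous_surf_components.fst

lemma H2Surf.continuous_grad (i : Fin 3) :
    Continuous fun φ : H2Surf Ω => φ.grad i :=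
  (continuous_apply i).comp continuous_surf_components.snd.fst

lemma IsTimeDeriv.map {X Y : Type*} [NormedAddCommGroup X] [NormedSpace ℝ X] [CompleteSpace X]
    [NormedAddCommGroup Y] [NormedSpace ℝ Y] [CompleteSpace Y] {y w : ℝ → X}
    (hyw : IsTimeDeriv y w) (A : X →L[ℝ] Y) :
    IsTimeDeriv (fun t => A (y t)) (fun t => A (w t)) := by
  refine ⟨fun T hT => A.comp_memLp' (hyw.1 T hT), fun t ht => ?_⟩
  have hint : IntervalIntegrable w volume 0 t := by
    rcases ht.eq_or_lt with h0 | h0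
    · rw [← h0]
    · rw [intervalIntegrable_iff_integrableOn_Ioc_of_le ht]
      exact (hyw.1 t h0).integrable le_top
  change A (y t) = A (y 0) + ∫ s in (0 : ℝ)..t, A (w s)
  rw [hyw.2 t ht, map_add, ContinuousLinearMap.intervalIntegral_comp_comm A hint]

lemma IsTimeDeriv.add {X : Type*} [NormedAddCommGroup X] [NormedSpace ℝ X] {y w z v : ℝ → X}
    (hyw : IsTimeDeriv y w) (hzv : IsTimeDeriv z v) :
    IsTimeDeriv (fun t => y t + z t) (fun t => w t + v t) := by
  refine ⟨fun T hT => (hyw.1 T hT).add (hzv.1 T hT), fun t ht => ?_⟩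
  have hint : ∀ {y w : ℝ → X}, IsTimeDeriv y w → IntervalIntegrable w volume 0 t := by
    intro y w hy
    rcases ht.eq_or_lt with h0 | h0
    · rw [← h0]
    · rw [intervalIntegrable_iff_integrableOn_Ioc_of_le ht]
      exact (hy.1 t h0).integrable le_top
  change y t + z t = y 0 + z 0 + ∫ s in (0 : ℝ)..t, (w s + v s)
  rw [hyw.2 t ht, hzv.2 t ht, intervalIntegral.integral_add (hint hyw) (hint hzv)]
  abel

/-- The ℓ² product makes the pair of velocities a single Hilbert space velocity with the norm of the
final statement. -/
lemma IsTimeDeriv.prod {X Y : Type*} [NormedAddCommGroup X] [NormedSpace ℝ X] [CompleteSpace X]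
    [NormedAddCommGroup Y] [NormedSpace ℝ Y] [CompleteSpace Y] {y w : ℝ → X} {z v : ℝ → Y}
    (hyw : IsTimeDeriv y w) (hzv : IsTimeDeriv z v) :
    IsTimeDeriv (fun t => WithLp.toLp 2 (y t, z t)) (fun t => WithLp.toLp 2 (w t, v t)) := by
  let A : X →L[ℝ] WithLp 2 (X × Y) :=
    ((WithLp.prodContinuousLinearEquiv 2 ℝ X Y).symm : X × Y →L[ℝ] WithLp 2 (X × Y)).comp
      (ContinuousLinearMap.inl ℝ X Y)
  let B : Y →L[ℝ] WithLp 2 (X × Y) :=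
    ((WithLp.prodContinuousLinearEquiv 2 ℝ X Y).symm : X × Y →L[ℝ] WithLp 2 (X × Y)).comp
      (ContinuousLinearMap.inr ℝ X Y)
  have hAB : ∀ a b, WithLp.toLp 2 (a, b) = A a + B b := by
    intro a b
    change _ = WithLp.toLp 2 (a, (0 : Y)) + WithLp.toLp 2 ((0 : X), b)
    rw [← WithLp.toLp_add]
    simp
  simp only [hAB]
  exact (hyw.map A).add (hzv.map B)

/-- Times at which an almost sure property holds accumulate from the left. -/
lemma exists_seq_tendsto_of_ae {p : ℝ → Prop} {a t : ℝ} (hat : a < t)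
    (hp : ∀ᵐ s, s ∈ Ioo a t → p s) :
    ∃ s : ℕ → ℝ, (∀ n, s n ∈ Ioo a t ∧ p (s n)) ∧ Tendsto s atTop (𝓝 t) := by
  have hex : ∀ n : ℕ, ∃ s, s ∈ Ioo (max a (t - 1 / (n + 1))) t ∧ p s := by
    intro n
    have hlt : max a (t - 1 / ((n : ℝ) + 1)) < t :=
      max_lt hat (sub_lt_self _ Nat.one_div_pos_of_nat)
    by_contra hcon
    push Not at hcon
    have h0 : volume (Ioo (max a (t - 1 / ((n : ℝ) + 1))) t) = 0 :=
      measure_mono_null (t := {s | ¬ (s ∈ Ioo a t → p s)}) (fun s hs hs' =>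
        hcon s hs (hs' ⟨(le_max_left _ _).trans_lt hs.1, hs.2⟩)) (ae_iff.1 hp)
    rw [Real.volume_Ioo, ENNReal.ofReal_eq_zero] at h0
    linarith
  choose s hs hps using hex
  refine ⟨s, fun n => ⟨⟨(le_max_left _ _).trans_lt (hs n).1, (hs n).2⟩, hps n⟩, ?_⟩
  refine tendsto_of_tendsto_of_tendsto_of_le_of_le (g := fun n : ℕ => t - 1 / ((n : ℝ) + 1)) ?_
    tendsto_const_nhds (fun n => ((le_max_right _ _).trans_lt (hs n).1).le) fun n => (hs n).2.le
  simpa using tendsto_one_div_add_atTop_nhds_zero_nat.const_sub t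

/-- The bulk velocity at a time is bounded by its bounds along a sequence of times converging to
it. -/
lemma norm_bulk_velocity_le (hF : AnalyticOnNhd ℝ F univ) {u : ℕ → H2Bulk Ω} {u₀ : H2Bulk Ω}
    {w : ℕ → L2Bulk Ω} {w₀ : L2Bulk Ω} (hu : Tendsto u atTop (𝓝 u₀))
    (heq : ∀ n, ∀ᵐ x ∂(bulkMeasure Ω), w n x - (u n).laplacian x + deriv F ((u n).val x) = 0)
    (heq₀ : ∀ᵐ x ∂(bulkMeasure Ω), w₀ x - u₀.laplacian x + deriv F (u₀.val x) = 0)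
    {c : ℝ} (hc : 0 ≤ c) (hw : ∀ n, ‖w n‖ ≤ c) : ‖w₀‖ ≤ c := by
  have t1 : Tendsto (fun n => (u n).laplacian) atTop (𝓝 u₀.laplacian) :=
    (H2Bulk.continuous_laplacian.tendsto u₀).comp hu
  have t2 : Tendsto (fun n => (u n).val) atTop (𝓝 u₀.val) :=
    (H2Bulk.continuous_val.tendsto u₀).comp hu
  -- Along a common subsequence both Δu and u converge a.e.; the equation then forces a.e.
  -- convergence of the velocities, and Fatou's lemma applies.
  obtain ⟨ns, hns, hae1⟩ := (tendstoInMeasure_of_tendsto_Lp t1).exists_seq_tendsto_ae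
  obtain ⟨ms, hms, hae2⟩ := (tendstoInMeasure_of_tendsto_Lp
    (t2.comp hns.tendsto_atTop)).exists_seq_tendsto_ae
  have hdF : Continuous (deriv F) := (differentiable_of_analyticOnNhd hF.deriv).continuous
  have hlim : ∀ᵐ x ∂(bulkMeasure Ω), Tendsto (fun n => w (ns (ms n)) x) atTop (𝓝 (w₀ x)) := by
    filter_upwards [hae1, hae2, ae_all_iff.2 heq, heq₀] with x h1 h2 h3 h4
    have h5 : ∀ n, w n x = (u n).laplacian x - deriv F ((u n).val x) := fun n => by
      linarith [h3 n]
    have h6 : w₀ x = u₀.laplacian x - deriv F (u₀.val x) := by linarith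
    simp only [h5, h6]
    exact (h1.comp hms.tendsto_atTop).sub ((hdF.tendsto _).comp h2)
  have hfatou := Lp.eLpNorm_lim_le_liminf_eLpNorm (p := 2)
    (fun n => Lp.aestronglyMeasurable (w (ns (ms n)))) w₀ hlim
  have hb : ∀ n, eLpNorm (w n) 2 (bulkMeasure Ω) ≤ ENNReal.ofReal c := fun n => by
    rw [← ENNReal.ofReal_toReal (Lp.memLp (w n)).eLpNorm_ne_top, ← Lp.norm_def]
    exact ENNReal.ofReal_le_ofReal (hw n)
  rw [Lp.norm_def]
  refine ENNReal.toReal_le_of_le_ofReal hc (hfatou.trans ?_)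
  exact (liminf_le_liminf (.of_forall fun n => hb _)).trans (by simp)

lemma hasSurfaceGradient_toLp (hΩ : IsSmoothBoundedDomain Ω) {ξ : E3 → ℝ} (hξ : ContDiff ℝ ∞ ξ) :
    HasSurfaceGradient Ω ((hΩ.memLp_surf hξ.continuous).toLp)
      (fun i => (hΩ.memLp_surfaceGradient hξ i).toLp) := by
  have key : ∀ {f : E3 → ℝ} (hf : MemLp f 2 (surfaceMeasure Ω)),
      eLpNorm (fun x => f x - (hf.toLp f : L2Surf Ω) x) 2 (surfaceMeasure Ω) = 0 := by
    intro f hf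
    rw [eLpNorm_congr_ae (g := 0), eLpNorm_zero]
    filter_upwards [hf.coeFn_toLp] with x hx
    simp [hx]
  refine ⟨fun _ => ξ, fun _ => hξ, ?_, fun i => ?_⟩
  · simp only [key]; exact tendsto_const_nhds
  · simp only [key]; exact tendsto_const_nhds

/-- The surface velocity at a time is bounded by its bounds along a sequence of times converging to
it. -/
lemma norm_surface_velocity_le (hΩ : IsSmoothBoundedDomain Ω) {p q : ℝ} (hq : 0 ≤ q)
    (hh : CouplingAssumption q h) (hF : PotentialAssumption p q F FΓ)
    {u : ℕ → H2Bulk Ω} {u₀ : H2Bulk Ω} {φ : ℕ → H2Surf Ω} {φ₀ : H2Surf Ω}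
    {w : ℕ → L2Bulk Ω} {w₀ : L2Bulk Ω} {v d γ L : ℕ → L2Surf Ω} {v₀ d₀ γ₀ L₀ : L2Surf Ω}
    (hφ : Tendsto φ atTop (𝓝 φ₀)) (hd : Tendsto d atTop (𝓝 d₀))
    (hconf : ∀ n, IsConfiguration K F FΓ h (u n) (φ n) (w n) (v n) (d n) (γ n) (L n))
    (hconf₀ : IsConfiguration K F FΓ h u₀ φ₀ w₀ v₀ d₀ γ₀ L₀)
    {c : ℝ} (hv : ∀ n, ‖v n‖ ≤ c) : ‖v₀‖ ≤ c := by
  have := hΩ.isFiniteMeasure_surface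
  obtain ⟨C, m, hC0, hC⟩ := exists_surface_velocity_sub_le hΩ hq hh hF (K := K)
  have t1 : Tendsto (fun n => (φ n).val) atTop (𝓝 φ₀.val) :=
    (H2Surf.continuous_val.tendsto φ₀).comp hφ
  have t2 : ∀ i, Tendsto (fun n => (φ n).grad i) atTop (𝓝 (φ₀.grad i)) := fun i =>
    ((H2Surf.continuous_grad i).tendsto φ₀).comp hφ
  -- The Laplace–Beltrami term passes to the limit only weakly, through convergence of surface
  -- gradients, and the remaining terms against bounded functions; hence testing with smooth ξ.
  have hsmooth : ∀ ξ : E3 → ℝ, ContDiff ℝ ∞ ξ → ∀ X : L2Surf Ω, X =ᵐ[surfaceMeasure Ω] ξ →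
      ⟪v₀, X⟫ ≤ c * ‖X‖ := by
    intro ξ hξ X hX
    obtain rfl : X = (hΩ.memLp_surf hξ.continuous).toLp := by
      refine Lp.ext (hX.trans ?_)
      exact (hΩ.memLp_surf hξ.continuous).coeFn_toLp.symm
    set X := (hΩ.memLp_surf hξ.continuous).toLp
    obtain ⟨B, hB⟩ := hΩ.isCompact_frontier.exists_bound_of_continuousOn hξ.continuous.continuousOn
    have hB' : ∀ᵐ x ∂(surfaceMeasure Ω), |X x| ≤ |B| := by
      have h1 : ∀ᵐ x ∂(surfaceMeasure Ω), ‖ξ x‖ ≤ B :=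
        (ae_restrict_iff' isClosed_frontier.measurableSet).2 (.of_forall hB)
      filter_upwards [hX, h1] with x r1 r2
      rw [r1]
      exact r2.trans (le_abs_self B)
    have hG := hasSurfaceGradient_toLp hΩ hξ
    have hL : Tendsto (fun n => ⟪L n, X⟫) atTop (𝓝 ⟪L₀, X⟫) := by
      have hLn := fun n => (hconf n).laplaceBeltrami.inner_eq hΩ hG
      have hL0 := hconf₀.laplaceBeltrami.inner_eq hΩ hG
      rw [hL0]
      simp only [X, hLn]
      exact (tendsto_finsetSum _ fun i _ => (t2 i).inner tendsto_const_nhds).neg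
    have hbound := fun n => hC _ _ _ _ _ _ _ _ _ _ _ _ _ _ hconf₀ (hconf n) X |B|
      (abs_nonneg B) hB'
    have hR : Tendsto (fun n => |B| * (C * (‖(φ n).val - φ₀.val‖ *
        (1 + ‖φ₀.val‖ * (‖φ₀.val‖ + ∑ i, ‖φ₀.grad i‖) ^ m +
          ‖(φ n).val‖ * (‖(φ n).val‖ + ∑ i, ‖(φ n).grad i‖) ^ m + ‖d₀‖) + ‖d n - d₀‖)))
        atTop (𝓝 0) := by
      have r1 : Tendsto (fun n => ‖(φ n).val - φ₀.val‖) atTop (𝓝 0) :=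
        tendsto_iff_norm_sub_tendsto_zero.1 t1
      have r2 : Tendsto (fun n => ‖d n - d₀‖) atTop (𝓝 0) :=
        tendsto_iff_norm_sub_tendsto_zero.1 hd
      have r3 := t1.norm.mul ((t1.norm.add
        (tendsto_finsetSum Finset.univ fun i _ => (t2 i).norm)).pow m)
      have r4 := (((r1.mul ((r3.const_add
        (1 + ‖φ₀.val‖ * (‖φ₀.val‖ + ∑ i, ‖φ₀.grad i‖) ^ m)).add_const ‖d₀‖)).add r2).const_mul
          C).const_mul |B|
      simpa using r4
    have hdiff : Tendsto (fun n => ⟪(v n - v₀) - (L n - L₀), X⟫) atTop (𝓝 0) :=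
      squeeze_zero_norm hbound hR
    have hvX : Tendsto (fun n => ⟪v n, X⟫) atTop (𝓝 ⟪v₀, X⟫) := by
      have e : ∀ n, ⟪v n, X⟫ = ⟪(v n - v₀) - (L n - L₀), X⟫ + ⟪v₀, X⟫ + (⟪L n, X⟫ - ⟪L₀, X⟫) := by
        intro n
        simp only [inner_sub_left]
        ring
      simp only [e]
      simpa using (hdiff.add_const ⟪v₀, X⟫).add (hL.sub_const ⟪L₀, X⟫)
    refine le_of_tendsto hvX (.of_forall fun n => (real_inner_le_norm _ _).trans ?_)
    exact mul_le_mul_of_nonneg_right (hv n) (norm_nonneg _)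
  have hclosed : IsClosed {X : L2Surf Ω | ⟪v₀, X⟫ ≤ c * ‖X‖} :=
    isClosed_le (continuous_const.inner continuous_id) (continuous_const.mul continuous_norm)
  -- Density extends the bound to all of L²(Γ), in particular to the test function v₀.
  have hdense := MeasureTheory.Lp.dense_hasCompactSupport_contDiff (F := ℝ) (p := 2)
    (μ := surfaceMeasure Ω) (by norm_num)
  have hall : ∀ X : L2Surf Ω, ⟪v₀, X⟫ ≤ c * ‖X‖ := by
    intro X
    refine closure_minimal ?_ hclosed (hdense X)
    intro X hX
    obtain ⟨ξ, h1, _, h3⟩ := hX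
    exact hsmooth ξ h3 X h1
  have h1 := hall v₀
  rw [real_inner_self_eq_norm_sq, sq] at h1
  rcases (norm_nonneg v₀).eq_or_lt with h0 | h0
  · rw [← h0]
    exact (norm_nonneg _).trans (hv 0)
  · exact le_of_mul_le_mul_right h1 h0

/-- The family `d` satisfies the boundary relations at each time separately; continuity comes from
`IsConfiguration.norm_normalDeriv_sub_le`, since u, Δu and φ are continuous in L². -/
lemma tendsto_normalDeriv (hΩ : IsSmoothBoundedDomain Ω) (hK : 0 < K) {q : ℝ}
    (hh : CouplingAssumption q h) {u : ℝ → H2Bulk Ω} {φ : ℝ → H2Surf Ω} {w : ℝ → L2Bulk Ω}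
    {v d γ L : ℝ → L2Surf Ω} (hu : ContinuousOn u (Ici 0)) (hφ : ContinuousOn φ (Ici 0))
    (hconf : ∀ t > 0, IsConfiguration K F FΓ h (u t) (φ t) (w t) (v t) (d t) (γ t) (L t))
    {t : ℝ} (ht : 0 < t) : Tendsto d (𝓝 t) (𝓝 (d t)) := by
  obtain ⟨M, hM⟩ := hh.bounded_deriv
  have hut : Tendsto u (𝓝 t) (𝓝 (u t)) := hu.continuousAt (Ici_mem_nhds ht)
  have hφt : Tendsto φ (𝓝 t) (𝓝 (φ t)) := hφ.continuousAt (Ici_mem_nhds ht)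
  have t1 := tendsto_iff_norm_sub_tendsto_zero.1 ((H2Bulk.continuous_val.tendsto _).comp hut)
  have t2 := tendsto_iff_norm_sub_tendsto_zero.1
    ((H2Bulk.continuous_laplacian.tendsto _).comp hut)
  have t3 := tendsto_iff_norm_sub_tendsto_zero.1 ((H2Surf.continuous_val.tendsto _).comp hφt)
  have hlim : Tendsto (fun s => (M / K) ^ 2 * ‖(φ s).val - (φ t).val‖ ^ 2 +
      2 / K * (‖(u s).laplacian - (u t).laplacian‖ * ‖(u s).val - (u t).val‖)) (𝓝 t) (𝓝 0) := by
    simpa using ((t3.pow 2).const_mul ((M / K) ^ 2)).add ((t2.mul t1).const_mul (2 / K))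
  have hsq : Tendsto (fun s => ‖d s - d t‖ ^ 2) (𝓝 t) (𝓝 0) := by
    refine squeeze_zero' (.of_forall fun _ => sq_nonneg _) ?_ hlim
    filter_upwards [lt_mem_nhds ht] with s hs
    have h1 := (hconf t ht).norm_normalDeriv_sub_le hΩ hh.analytic hM (hconf s hs)
    -- Young's inequality, moving the factor ‖d s − d t‖ to the left side.
    have h2 := sq_nonneg (M * ‖(φ s).val - (φ t).val‖ - K * ‖d s - d t‖)
    have h3 : K ^ 2 * ‖d s - d t‖ ^ 2 ≤ M ^ 2 * ‖(φ s).val - (φ t).val‖ ^ 2 +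
        2 * K * (‖(u s).laplacian - (u t).laplacian‖ * ‖(u s).val - (u t).val‖) := by
      have := mul_le_mul_of_nonneg_left h1 (by positivity : 0 ≤ 2 * K)
      nlinarith
    have h4 : (M / K) ^ 2 * ‖(φ s).val - (φ t).val‖ ^ 2 +
        2 / K * (‖(u s).laplacian - (u t).laplacian‖ * ‖(u s).val - (u t).val‖) =
        (M ^ 2 * ‖(φ s).val - (φ t).val‖ ^ 2 +
        2 * K * (‖(u s).laplacian - (u t).laplacian‖ * ‖(u s).val - (u t).val‖)) / K ^ 2 := by
      field_simp
    rw [h4, le_div_iff₀ (by positivity)]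
    linarith
  rw [tendsto_iff_norm_sub_tendsto_zero]
  simpa [Real.sqrt_sq] using hsq.sqrt

end Trajectories

end BulkSurfaceAC

end

/-! ### The decay theorem. -/

theorem proposition5p1
    (Ω : Set BulkSurfaceAC.E3) (hΩ : BulkSurfaceAC.IsSmoothBoundedDomain Ω)
    (K : ℝ) (hK : 0 < K)
    (p q : ℝ) (hp0 : 0 ≤ p) (hp3 : p < 3) (hq : 0 ≤ q)
    (h F FΓ : ℝ → ℝ)
    (hh : BulkSurfaceAC.CouplingAssumption q h)
    (hF : BulkSurfaceAC.PotentialAssumption p q F FΓ)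
    (u₀ : BulkSurfaceAC.H2Bulk Ω) (φ₀ : BulkSurfaceAC.H2Surf Ω)
    (h₀ : ∃ d : BulkSurfaceAC.L2Surf Ω, BulkSurfaceAC.RobinCondition K h u₀ φ₀.val d)
    (u : ℝ → BulkSurfaceAC.H2Bulk Ω) (φ : ℝ → BulkSurfaceAC.H2Surf Ω)
    (ut : ℝ → BulkSurfaceAC.L2Bulk Ω) (φt : ℝ → BulkSurfaceAC.L2Surf Ω)
    (hsol : BulkSurfaceAC.IsGlobalStrongSolution Ω K F FΓ h u₀ φ₀ u φ ut φt) :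
    Filter.Tendsto (fun t : ℝ => Real.sqrt (‖ut t‖ ^ 2 + ‖φt t‖ ^ 2))
      Filter.atTop (nhds 0) := by
  open BulkSurfaceAC in
  have hex : ∀ t : ℝ, ∃ d γ L : L2Surf Ω, 0 < t →
      IsConfiguration K F FΓ h (u t) (φ t) (ut t) (φt t) d γ L := by
    intro t
    by_cases ht : 0 < t
    · obtain ⟨d, L, ⟨hd, γ, hγ, hrob⟩, hL, hsurf⟩ := hsol.boundary_equations t ht
      exact ⟨d, γ, L, fun _ => ⟨hd, hγ, hrob, hL, hsol.bulk_equation t ht, hsurf⟩⟩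
    -- Values at nonpositive times are placeholders, making the choice total in t.
    · exact ⟨0, 0, 0, fun ht' => absurd ht' ht⟩
  choose d γ L hconf using hex
  obtain ⟨C, hC0, hC⟩ := BulkSurfaceAC.exists_energy_semiconvex hΩ hK hh hF
  obtain ⟨m, hm⟩ := BulkSurfaceAC.exists_energy_ge (K := K) hΩ hF
  have hw : ∀ t, ‖(WithLp.toLp 2 (ut t, φt t) :
      WithLp 2 (BulkSurfaceAC.L2Bulk Ω × BulkSurfaceAC.L2Surf Ω))‖ =
      Real.sqrt (‖ut t‖ ^ 2 + ‖φt t‖ ^ 2) := fun t => WithLp.prod_norm_eq_of_L2 _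
  simp only [← hw]
  -- Each component of the velocity inherits the bound c separately, so the pair is bounded by √2·c
  -- ≤ 2c.
  refine BulkSurfaceAC.tendsto_velocity_of_gradientFlow (C₀ := 2)
    (E := fun t => BulkSurfaceAC.energy K F FΓ (u t) (φ t) (d t))
    (Λ := fun t => C * (1 + ‖d t‖ ^ 2))
    (hsol.timeDeriv_bulk.prod hsol.timeDeriv_surf) ?_ ?_ ?_ ?_ ?_
  · intro s hs t ht
    have := hC _ _ _ _ _ _ _ _ _ _ _ _ _ _ (hconf s hs) (hconf t ht)
    rw [← WithLp.toLp_sub, WithLp.prod_inner_apply, WithLp.prod_norm_sq_eq_of_L2]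
    exact this
  · intro a b ha
    have hd : ContinuousOn (fun s => C * (1 + ‖d s‖ ^ 2)) (Set.Icc a b) := by
      intro s hs
      have hds : ContinuousAt d s := BulkSurfaceAC.tendsto_normalDeriv hΩ hK hh
        hsol.continuous_bulk hsol.continuous_surf hconf (ha.trans_le hs.1)
      exact (continuousAt_const.mul (continuousAt_const.add (hds.norm.pow 2))).continuousWithinAt
    obtain ⟨B, hB⟩ := isCompact_Icc.bddAbove_image hd
    exact ⟨B, fun s hs => hB (Set.mem_image_of_mem _ hs)⟩
  · intro e
    -- On E ≤ e the lower bound for the energy gives (K/2)‖d‖² ≤ e + m.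
    refine ⟨C * (1 + (e + m) * (2 / K)), fun s _ hs => ?_⟩
    refine mul_le_mul_of_nonneg_left (add_le_add_right ?_ 1) hC0
    have h1 : K / 2 * ‖d s‖ ^ 2 ≤ e + m := by linarith [hm (u s) (φ s) (d s)]
    calc ‖d s‖ ^ 2 = K / 2 * ‖d s‖ ^ 2 * (2 / K) := by field_simp
      _ ≤ (e + m) * (2 / K) := mul_le_mul_of_nonneg_right h1 (by positivity)
  · refine ⟨-m, fun s _ => ?_⟩
    have h1 : 0 ≤ K / 2 * ‖d s‖ ^ 2 := by positivity
    linarith [hm (u s) (φ s) (d s)]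
  · intro t ht c hc a ha hae
    obtain ⟨s, hs, hst⟩ := BulkSurfaceAC.exists_seq_tendsto_of_ae ha.2 hae
    have hs0 : ∀ n, 0 < s n := fun n => ha.1.trans_lt (hs n).1.1
    have hut : Tendsto u (𝓝 t) (𝓝 (u t)) := hsol.continuous_bulk.continuousAt (Ici_mem_nhds ht)
    have hφt : Tendsto φ (𝓝 t) (𝓝 (φ t)) := hsol.continuous_surf.continuousAt (Ici_mem_nhds ht)
    have hdt : Tendsto d (𝓝 t) (𝓝 (d t)) := BulkSurfaceAC.tendsto_normalDeriv hΩ hK hh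
      hsol.continuous_bulk hsol.continuous_surf hconf ht
    have h1 : ‖ut t‖ ≤ c :=
      BulkSurfaceAC.norm_bulk_velocity_le hF.analytic_bulk (hut.comp hst)
        (fun n => hsol.bulk_equation (s n) (hs0 n)) (hsol.bulk_equation t ht) hc fun n => by
          refine le_trans ?_ ((hw (s n)).symm.trans_le (hs n).2)
          exact Real.le_sqrt_of_sq_le (le_add_of_nonneg_right (sq_nonneg _))
    have h2 : ‖φt t‖ ≤ c :=
      BulkSurfaceAC.norm_surface_velocity_le hΩ hq hh hF (hφt.comp hst) (hdt.comp hst)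
        (fun n => hconf (s n) (hs0 n)) (hconf t ht) fun n => by
          refine le_trans ?_ ((hw (s n)).symm.trans_le (hs n).2)
          exact Real.le_sqrt_of_sq_le (le_add_of_nonneg_left (sq_nonneg _))
    refine (hw t).trans_le ?_
    rw [Real.sqrt_le_left (by positivity)]
    nlinarith [norm_nonneg (ut t), norm_nonneg (φt t)]
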